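/- Let $M\subset\mathbb R^N$ be an $m$-dimensional smooth (embedded, $C^\infty$) oriented submanifold. Work in the geometric (Clifford) algebra of $\mathbb R^N$, with $v^2=\langle v,v\rangle$ for vectors $v$, identified as a vector space with the exterior algebra $\bigwedge_*\mathbb R^N$; juxtaposition is the geometric product, $\wedge$ the exterior product, $\lrcorner$ the left contraction, and $A^{\mathbf t}$ the reversion of $A$. For $F:M\to\bigwedge_*\mathbb R^N$ and a tangent vector $a$ at $x\in M$ let $(a\cdot\partial)F$ be the derivative of $F$ along curves in $M$ through $x$ with velocity $a$, and for an orthonormal basis $\tau_1,\dots,\tau_m$ of $T_xM$ put $$\partial\lrcorner F=\sum_{j}\tau_j\lrcorner(\tau_j\cdot\partial)F,\qquad \partial\wedge F=\sum_{j}\tau_j\wedge(\tau_j\cdot\partial)F .$$ The graded Laplacian (the grade-preserving part of the second vector derivative) is $$\diamondsuit F=\partial\lrcorner(\partial\wedge F)+\partial\wedge(\partial\lrcorner F).$$ Let $\mathfrak T$ be the Gauss map of $M$, i.e. the continuous field of unit $m$-blades $\mathfrak T(x)=\tau_1\wedge\dots\wedge\tau_m$ ($\tau$ a positively oriented orthonormal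 basis of $T_xM$; for $m=0$, $\mathfrak T(x)=\pm1$) representing the oriented tangent spaces. Let $\mathcal N=\star\mathfrak T=\mathfrak T^{\mathbf t}\,(e_1\wedge\dots\wedge e_N)$ be the normal blade, with $e_1,\dots,e_N$ the standard basis. Let $H=\sum_j \mathrm{II}(\tau_j,\tau_j)$ be the mean curvature vector, the trace (without factor $1/m$) of the second fundamental form $\mathrm{II}(a,b)=((a\cdot\partial)b)^\perp$. Then all directional derivatives involved in $H$, $\partial\wedge H$, $\diamondsuit\mathfrak T$ and $\diamondsuit\mathcal N$ exist, and at every point of $M$ $$\diamondsuit\mathfrak T=-(\partial\wedge H)\,\mathfrak T\qquad\text{and}\qquad \diamondsuit\mathcal N=-(\partial\wedge H)\,\mathcal N .$$ -/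

import Mathlib

open scoped ContDiff Topology

noncomputable section

namespace GeomCalc

/-- The Euclidean space `ℝ^N`. -/
abbrev E (N : ℕ) : Type := EuclideanSpace ℝ (Fin N)

/-! ### Geometric algebra of `ℝ^N` -/

/-- The Euclidean quadratic form `v ↦ ⟨v, v⟩`. -/
def quad (N : ℕ) : QuadraticForm ℝ (E N) := LinearMap.BilinMap.toQuadraticMap (innerₗ (E N))

/-- The geometric (Clifford) algebra of `ℝ^N`, in which `v * v = ⟨v, v⟩`; as a vector space it is
identified with the exterior algebra by `toExt`. -/
abbrev GA (N : ℕ) : Type := CliffordAlgebra (quad N)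

/-- The inclusion of vectors into the geometric algebra. -/
def vec {N : ℕ} : E N →ₗ[ℝ] GA N := CliffordAlgebra.ι (quad N)

/-- The canonical linear identification of the geometric algebra with the exterior algebra. -/
def toExt (N : ℕ) : GA N ≃ₗ[ℝ] ExteriorAlgebra ℝ (E N) := CliffordAlgebra.equivExterior (quad N)

/-- The standard basis `e_{i₁} ∧ … ∧ e_{i_r}`, `i₁ < … < i_r`, of the geometric algebra. -/
def stdBasisGA (N : ℕ) : Module.Basis (Finset (Fin N)) ℝ (GA N) :=
  (EuclideanSpace.basisFun (Fin N) ℝ).toBasis.ExteriorAlgebra.map (toExt N).symm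

/-- Coordinates with respect to the standard basis. -/
def coordsGA (N : ℕ) : GA N →ₗ[ℝ] EuclideanSpace ℝ (Finset (Fin N)) :=
  ((WithLp.linearEquiv 2 ℝ (Finset (Fin N) → ℝ)).symm.toLinearMap).comp
    (stdBasisGA N).equivFun.toLinearMap

theorem coordsGA_injective (N : ℕ) : Function.Injective (coordsGA N) :=
  (WithLp.linearEquiv 2 ℝ (Finset (Fin N) → ℝ)).symm.injective.comp
    (stdBasisGA N).equivFun.injective

/-- The norm on multivectors, for which the basis elements `e_{i₁} ∧ … ∧ e_{i_r}` are orthonormal. -/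
instance instNormedAddCommGroupGA (N : ℕ) : NormedAddCommGroup (GA N) :=
  NormedAddCommGroup.induced (GA N) (EuclideanSpace ℝ (Finset (Fin N))) (coordsGA N)
    (coordsGA_injective N)

instance instNormedSpaceGA (N : ℕ) : NormedSpace ℝ (GA N) :=
  NormedSpace.induced ℝ (GA N) (EuclideanSpace ℝ (Finset (Fin N))) (coordsGA N)

/-- The exterior product of multivectors. -/
def wedge {N : ℕ} (A B : GA N) : GA N := (toExt N).symm (toExt N A * toExt N B)

/-- The left contraction `a ⌟ B` of a multivector by a vector. -/
def contract {N : ℕ} (a : E N) (B : GA N) : GA N :=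
  CliffordAlgebra.contractLeft (innerₗ (E N) a) B

/-- The exterior product `v₁ ∧ … ∧ v_m` of vectors. -/
def blade {N m : ℕ} (v : Fin m → E N) : GA N :=
  (toExt N).symm (ExteriorAlgebra.ιMulti ℝ m v)

/-- The unit pseudoscalar `e₁ ∧ … ∧ e_N`. -/
def pseudoscalar (N : ℕ) : GA N := blade (fun i : Fin N => EuclideanSpace.single i (1 : ℝ))

/-- The Hodge dual `⋆A = Aᵗ i`, with `Aᵗ` the reversion of `A` and `i` the pseudoscalar. -/
def hodge {N : ℕ} (A : GA N) : GA N := CliffordAlgebra.reverse A * pseudoscalar N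

/-! ### Submanifolds, tangent spaces, Gauss map -/

/-- `M` is an `m`-dimensional (embedded) smooth submanifold of `ℝ^N`: near each of its points there
is a smooth diffeomorphism `Φ` between open subsets of `ℝ^N` that carries `M` to `ℝ^m × {0}`. -/
def IsSmoothSubmanifold {N : ℕ} (m : ℕ) (M : Set (E N)) : Prop :=
  m ≤ N ∧ ∀ x ∈ M, ∃ Φ : OpenPartialHomeomorph (E N) (E N), x ∈ Φ.source ∧
    ContDiffOn ℝ ∞ Φ Φ.source ∧ ContDiffOn ℝ ∞ Φ.symm Φ.target ∧
    ∀ y ∈ Φ.source, (y ∈ M ↔ ∀ i : Fin N, m ≤ (i : ℕ) → Φ y i = 0)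

/-- `γ` is a curve through `x` that runs in `M` near time `0`, with velocity `a` at time `0`. -/
def IsCurveIn {N : ℕ} (M : Set (E N)) (x a : E N) (γ : ℝ → E N) : Prop :=
  γ 0 = x ∧ (∀ᶠ t in 𝓝 (0 : ℝ), γ t ∈ M) ∧ HasDerivAt γ a 0

/-- The tangent space of `M` at `x`: the velocities at `x` of curves in `M` through `x`. (For a
submanifold these already form a linear subspace, so that taking the span changes nothing.) -/
def tangentSpace {N : ℕ} (M : Set (E N)) (x : E N) : Submodule ℝ (E N) :=
  Submodule.span ℝ {a | ∃ γ, IsCurveIn M x a γ}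

/-- `T` is the Gauss map of `M` for one of its orientations. An orientation of `M` is given as in
geometric measure theory, by a continuous field `T` of unit `m`-blades with `T x` representing the
tangent space, i.e. `T x = ± τ₁ ∧ … ∧ τ_m` for an orthonormal basis `τ` of the tangent space at `x`.
(For `m ≥ 1` the sign can be absorbed into `τ`; for `m = 0` both `T x = 1` and `T x = -1` occur.) -/
def IsGaussMap {N : ℕ} (m : ℕ) (M : Set (E N)) (T : E N → GA N) : Prop :=
  ContinuousOn T M ∧ ∀ x ∈ M, ∃ τ : OrthonormalBasis (Fin m) ℝ (tangentSpace M x),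
    T x = blade (fun j => (τ j : E N)) ∨ T x = -blade (fun j => (τ j : E N))

/-! ### Differential operators on `M` -/

section Deriv

variable {N : ℕ} {V : Type*} [NormedAddCommGroup V] [NormedSpace ℝ V]

/-- The directional derivative `(a·∂)F` at `x` exists and equals `L`: `F` has derivative `L` along
every curve in `M` through `x` with velocity `a`. -/
def HasDirDeriv (M : Set (E N)) (F : E N → V) (x a : E N) (L : V) : Prop :=
  ∀ γ, IsCurveIn M x a γ → HasDerivAt (fun t => F (γ t)) L 0

open Classical in
/-- The directional derivative `(a·∂)F` at `x ∈ M`, for `a` tangent to `M` at `x` (by convention `0`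
if it does not exist). -/
def dirDeriv (M : Set (E N)) (F : E N → V) (x a : E N) : V :=
  if h : ∃ L, HasDirDeriv M F x a L then h.choose else 0

/-- All directional derivatives of `F` in tangent directions exist at all points of `M`. -/
def DirDifferentiable (M : Set (E N)) (F : E N → V) : Prop :=
  ∀ x ∈ M, ∀ a ∈ tangentSpace M x, ∃ L, HasDirDeriv M F x a L

/-- An orthonormal basis `τ` of the tangent space at `x`. -/
def frame (M : Set (E N)) (x : E N) :
    OrthonormalBasis (Fin (Module.finrank ℝ (tangentSpace M x))) ℝ (tangentSpace M x) :=
  stdOrthonormalBasis ℝ (tangentSpace M x)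

/-- The divergence `∂ ⌟ F = ∑ⱼ τⱼ ⌟ (τⱼ·∂)F`. -/
def divergence (M : Set (E N)) (F : E N → GA N) (x : E N) : GA N :=
  ∑ j, contract (frame M x j : E N) (dirDeriv M F x (frame M x j))

/-- The curl `∂ ∧ F = ∑ⱼ τⱼ ∧ (τⱼ·∂)F`. -/
def curl (M : Set (E N)) (F : E N → GA N) (x : E N) : GA N :=
  ∑ j, wedge (vec (frame M x j : E N)) (dirDeriv M F x (frame M x j))

/-- The graded Laplacian `◇F = ∂ ⌟ (∂ ∧ F) + ∂ ∧ (∂ ⌟ F)`. -/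
def gradedLaplacian (M : Set (E N)) (F : E N → GA N) (x : E N) : GA N :=
  divergence M (curl M F) x + curl M (divergence M F) x

/-- All the directional derivatives in the definition of `◇F` exist on `M`. -/
def HasGradedLaplacian (M : Set (E N)) (F : E N → GA N) : Prop :=
  DirDifferentiable M F ∧ DirDifferentiable M (curl M F) ∧ DirDifferentiable M (divergence M F)

/-- The tangential field `y ↦ P_y b`, with `P_y` the orthogonal projection onto the tangent space
at `y`; for `b` tangent at `x` it extends `b` to a tangent vector field. -/
def tangentialField (M : Set (E N)) (b y : E N) : E N := (tangentSpace M y).starProjection b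

/-- The second fundamental form `II_x(a, b) = ((a·∂)B)^⊥` of tangent vectors `a`, `b` at `x`: the
normal part of the derivative in direction `a` of a tangent vector field `B` that extends `b`. -/
def secondFundamentalForm (M : Set (E N)) (x a b : E N) : E N :=
  (tangentSpace M x)ᗮ.starProjection (dirDeriv M (tangentialField M b) x a)

/-- The mean curvature vector, i.e. the trace `H = ∑ⱼ II(τⱼ, τⱼ)` of the second fundamental form
(without a factor `1/m`). -/
def meanCurvature (M : Set (E N)) (x : E N) : E N :=
  ∑ j, secondFundamentalForm M x (frame M x j) (frame M x j)

end Deriv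

end GeomCalc

end

/-!
The Gauss map `T` of a submanifold has derivative `∂ₐT = ∑ⱼ II(a, τⱼ) ∧ (τⱼ ⌟ T)`
(`hasDirDeriv_gaussMap`): along a curve, `T` is up to a constant sign the normalization of the blade
of the tangent projections of a fixed orthonormal basis, the exterior product obeys the Leibniz rule,
and the normalizing factor is stationary because the displayed sum is left multiplication of `T` by
an element that changes sign under reversion.

Since the second fundamental form is symmetric and normal, summation over an orthonormal tangent
basis gives `∂ ⌟ T = 0` (`divergence_gaussMap`) and `∂ ∧ T = -H ∧ T` (`curl_gaussMap`), so
`◇T = -∂ ⌟ (H ∧ T)`. In the product rule for the last expression, the terms that differentiate `T`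
add up to a multiple of `∂ ⌟ T`. The terms that differentiate `H` add up to `(∂ ∧ H) T`, up to a
double contraction of `T` by the tangential part of `∂H`; this vanishes because that part,
`-⟨H, II⟩`, is symmetric (`inner_dirDeriv_meanCurvature_symm`).

For the normal blade, reversion acts on the values of `T` as a constant sign, and right
multiplication by the pseudoscalar interchanges contraction and exterior product with vectors, hence
`∂ ⌟` and `∂ ∧`; it therefore commutes with `◇`.

The analytic input is that the orthogonal projection onto the tangent space extends locally to a
smooth operator-valued function (`IsSmoothSubmanifold.exists_contDiffOn_tangentProj`), given by the
least-squares formula in a straightening chart. The second fundamental form is its derivative, and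
`H` is a trace of that derivative.
-/

noncomputable section

namespace GeomCalc

open scoped RealInnerProductSpace

variable {N m : ℕ}

/-! ### Algebra of vectors and blades -/

theorem vec_mul_vec_self (v : E N) : vec v * vec v = algebraMap ℝ (GA N) ⟪v, v⟫ :=
  CliffordAlgebra.ι_sq_scalar (quad N) v

theorem contract_vec_mul (v w : E N) (B : GA N) :
    contract v (vec w * B) = ⟪v, w⟫ • B - vec w * contract v B :=
  CliffordAlgebra.contractLeft_ι_mul _ _ _

theorem contract_one (v : E N) : contract v (1 : GA N) = 0 :=
  CliffordAlgebra.contractLeft_one _ _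

theorem contract_contract (v w : E N) (B : GA N) :
    contract v (contract w B) = -contract w (contract v B) :=
  CliffordAlgebra.contractLeft_comm _ _ _

theorem toExt_one : toExt N 1 = 1 :=
  CliffordAlgebra.changeForm_one CliffordAlgebra.changeForm.associated_neg_proof

theorem toExt_vec (v : E N) : toExt N (vec v) = ExteriorAlgebra.ι ℝ v :=
  CliffordAlgebra.changeForm_ι CliffordAlgebra.changeForm.associated_neg_proof v

theorem vec_mul_vec_add_swap (v w : E N) :
    vec v * vec w + vec w * vec v = algebraMap ℝ (GA N) (2 * ⟪v, w⟫) := by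
  refine (CliffordAlgebra.ι_mul_ι_add_swap v w).trans ?_
  simp only [quad, QuadraticMap.polar, LinearMap.BilinMap.toQuadraticMap_apply, innerₗ_apply_apply,
    inner_add_left, inner_add_right, real_inner_comm v w]
  congr 1
  ring

/-- The exterior product with a vector, in terms of the geometric product. -/
theorem wedge_vec (v : E N) (B : GA N) : wedge (vec v) B = vec v * B - contract v B := by
  rw [wedge, LinearEquiv.symm_apply_eq, toExt_vec, map_sub]
  have h1 : toExt N (vec v * B) = ExteriorAlgebra.ι ℝ v * toExt N B -
      CliffordAlgebra.contractLeft (QuadraticMap.associated (R := ℝ) (-quad N) v) (toExt N B) :=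
    CliffordAlgebra.changeForm_ι_mul CliffordAlgebra.changeForm.associated_neg_proof v B
  have h2 : toExt N (contract v B) = CliffordAlgebra.contractLeft (innerₗ (E N) v) (toExt N B) :=
    CliffordAlgebra.changeForm_contractLeft CliffordAlgebra.changeForm.associated_neg_proof _ B
  have h3 : QuadraticMap.associated (R := ℝ) (-quad N) v = -innerₗ (E N) v := by
    ext w
    simp [QuadraticMap.associated_apply, quad, inner_add_right,
      real_inner_comm v w]
    ring
  rw [h1, h2, h3, map_neg, LinearMap.neg_apply]
  abel

/-- The exterior product as a bilinear map. -/
def wedgeₗ (N : ℕ) : GA N →ₗ[ℝ] GA N →ₗ[ℝ] GA N :=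
  ((LinearMap.mul ℝ (ExteriorAlgebra ℝ (E N))).compl₁₂ (toExt N).toLinearMap
    (toExt N).toLinearMap).compr₂ (toExt N).symm.toLinearMap

/-- The exterior product of a vector and a multivector as a bilinear map. -/
def vecWedgeₗ (N : ℕ) : E N →ₗ[ℝ] GA N →ₗ[ℝ] GA N := (wedgeₗ N).comp vec

theorem vecWedgeₗ_apply (v : E N) (B : GA N) : vecWedgeₗ N v B = wedge (vec v) B := rfl

/-- The left contraction of a multivector by a vector as a bilinear map. -/
def contractₗ (N : ℕ) : E N →ₗ[ℝ] GA N →ₗ[ℝ] GA N :=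
  CliffordAlgebra.contractLeft.comp (innerₗ (E N))

theorem contractₗ_apply (v : E N) (B : GA N) : contractₗ N v B = contract v B := rfl

theorem contract_wedge (v w : E N) (B : GA N) :
    contract v (wedge (vec w) B) = ⟪v, w⟫ • B - wedge (vec w) (contract v B) := by
  rw [wedge_vec, wedge_vec, ← contractₗ_apply, map_sub, contractₗ_apply, contractₗ_apply,
    contract_vec_mul, contract_contract v w]
  abel

theorem wedge_wedge (v w : E N) (B : GA N) :
    wedge (vec v) (wedge (vec w) B) = -wedge (vec w) (wedge (vec v) B) := by
  rw [wedge_vec v, contract_wedge, wedge_vec w (wedge _ _), contract_wedge, wedge_vec, wedge_vec,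
    real_inner_comm v w]
  have h2 : vec v * (vec w * B) + vec w * (vec v * B) = (2 * ⟪v, w⟫) • B := by
    rw [← mul_assoc, ← mul_assoc, ← add_mul, vec_mul_vec_add_swap, Algebra.smul_def]
  rw [wedge_vec, wedge_vec, contract_contract w v]
  have h3 : vec v * (vec w * B) = (2 * ⟪v, w⟫) • B - vec w * (vec v * B) := by
    rw [← h2]; abel
  simp only [mul_sub, h3, mul_smul, two_smul]
  abel

theorem blade_zero (v : Fin 0 → E N) : blade v = 1 := by
  rw [blade, ExteriorAlgebra.ιMulti_zero_apply, LinearEquiv.symm_apply_eq, toExt_one]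

theorem blade_succ (v : Fin (m + 1) → E N) :
    blade v = wedge (vec (v 0)) (blade fun j => v j.succ) := by
  rw [blade, ExteriorAlgebra.ιMulti_succ_apply, wedge, blade, toExt_vec, LinearEquiv.apply_symm_apply]
  rfl

/-- A vector orthogonal to the factors of a blade contracts it to zero. -/
theorem contract_blade_of_orthogonal (w : E N) (v : Fin m → E N) (h : ∀ j, ⟪w, v j⟫ = 0) :
    contract w (blade v) = 0 := by
  induction m with
  | zero => rw [blade_zero, contract_one]
  | succ m ih =>
    rw [blade_succ, contract_wedge, h 0, ih _ fun j => h j.succ, zero_smul, ← vecWedgeₗ_apply,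
      map_zero, sub_zero]

/-- The exterior product of a blade with a vector in the span of its factors is zero. -/
theorem wedge_blade_of_mem_span (w : E N) (v : Fin m → E N)
    (h : w ∈ Submodule.span ℝ (Set.range v)) : wedge (vec w) (blade v) = 0 := by
  have : Submodule.span ℝ (Set.range v) ≤ LinearMap.ker ((vecWedgeₗ N).flip (blade v)) := by
    rw [Submodule.span_le]
    rintro _ ⟨j, rfl⟩
    have hb := blade_succ (Fin.cons (v j) v : Fin (m + 1) → E N)
    simp only [Fin.cons_zero, Fin.cons_succ] at hb
    rw [SetLike.mem_coe, LinearMap.mem_ker, LinearMap.flip_apply, vecWedgeₗ_apply, ← hb, blade,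
      ExteriorAlgebra.ιMulti_eq_zero_of_not_inj, map_zero]
    exact fun hi => absurd (@hi 0 j.succ (by simp)) (Fin.succ_ne_zero j).symm
  exact this h

/-- A blade with orthogonal factors is the geometric product of its factors. -/
theorem blade_succ_of_orthogonal (v : Fin (m + 1) → E N)
    (h : Pairwise fun i j => ⟪v i, v j⟫ = 0) :
    blade v = vec (v 0) * blade fun j => v j.succ := by
  rw [blade_succ, wedge_vec,
    contract_blade_of_orthogonal _ _ fun j => h (Fin.succ_ne_zero j).symm, sub_zero]

theorem reverse_vec_mul (v : E N) (B : GA N) :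
    CliffordAlgebra.reverse (vec v * B) = CliffordAlgebra.reverse B * vec v := by
  rw [CliffordAlgebra.reverse.map_mul, vec, CliffordAlgebra.reverse_ι]

theorem reverse_blade_mul_blade (v : Fin m → E N) (h : Orthonormal ℝ v) :
    CliffordAlgebra.reverse (blade v) * blade v = 1 := by
  induction m with
  | zero => rw [blade_zero, CliffordAlgebra.reverse.map_one, one_mul]
  | succ m ih =>
    rw [blade_succ_of_orthogonal v fun i j hij => h.2 hij, reverse_vec_mul, mul_assoc,
      ← mul_assoc (vec (v 0)), vec_mul_vec_self, real_inner_self_eq_norm_sq, h.1 0]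
    simpa [Function.comp_def] using ih _ (h.comp _ (Fin.succ_injective m))

theorem vec_mul_vec_of_orthogonal {v w : E N} (h : ⟪v, w⟫ = 0) :
    vec v * vec w = -(vec w * vec v) := by
  rw [eq_neg_iff_add_eq_zero, vec_mul_vec_add_swap, h, mul_zero, map_zero]

theorem blade_mul_vec_of_orthogonal (w : E N) (v : Fin m → E N)
    (hv : Pairwise fun i j => ⟪v i, v j⟫ = 0) (h : ∀ j, ⟪w, v j⟫ = 0) :
    blade v * vec w = (-1 : ℝ) ^ m • (vec w * blade v) := by
  induction m with
  | zero => simp [blade_zero]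
  | succ m ih =>
    rw [blade_succ_of_orthogonal v hv, mul_assoc,
      ih _ (fun i j hij => hv fun e => hij (Fin.succ_injective m e)) fun j => h j.succ,
      mul_smul_comm, ← mul_assoc, ← mul_assoc, vec_mul_vec_of_orthogonal (h 0), pow_succ]
    simp

/-- Reversion multiplies blades with `m` orthogonal factors by a scalar that depends on `m` only. -/
theorem exists_reverse_blade (N m : ℕ) : ∃ ε : ℝ, ∀ v : Fin m → E N,
    (Pairwise fun i j => ⟪v i, v j⟫ = 0) → CliffordAlgebra.reverse (blade v) = ε • blade v := by
  induction m with
  | zero => exact ⟨1, fun v _ => by rw [blade_zero, CliffordAlgebra.reverse.map_one, one_smul]⟩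
  | succ m ih =>
    obtain ⟨ε, hε⟩ := ih
    refine ⟨ε * (-1) ^ m, fun v hv => ?_⟩
    have hv' : Pairwise fun i j : Fin m => ⟪v i.succ, v j.succ⟫ = 0 :=
      fun i j hij => hv fun e => hij (Fin.succ_injective m e)
    rw [blade_succ_of_orthogonal v hv, reverse_vec_mul, hε _ hv', smul_mul_assoc,
      blade_mul_vec_of_orthogonal _ _ hv' fun j => hv (Fin.succ_ne_zero j).symm, smul_smul]

/-! ### Duality with respect to the pseudoscalar -/

theorem wedge_pseudoscalar (v : E N) : wedge (vec v) (pseudoscalar N) = 0 := by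
  refine wedge_blade_of_mem_span v _ ?_
  have h := (EuclideanSpace.basisFun (Fin N) ℝ).toBasis.span_eq
  rw [OrthonormalBasis.coe_toBasis] at h
  have h2 : (fun i : Fin N => EuclideanSpace.single i (1 : ℝ)) = EuclideanSpace.basisFun (Fin N) ℝ :=
    funext fun i => (EuclideanSpace.basisFun_apply _ _ _).symm
  rw [h2, h]
  trivial

theorem contract_mul_pseudoscalar (v : E N) (A : GA N) :
    contract v (A * pseudoscalar N) = wedge (vec v) A * pseudoscalar N := by
  have h1 : contract v (pseudoscalar N) = vec v * pseudoscalar N := by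
    have := wedge_pseudoscalar v
    rw [wedge_vec, sub_eq_zero] at this
    exact this.symm
  induction A using CliffordAlgebra.left_induction with
  | algebraMap r =>
    rw [← Algebra.smul_def, ← contractₗ_apply, map_smul, contractₗ_apply, h1,
      Algebra.algebraMap_eq_smul_one, ← vecWedgeₗ_apply, map_smul, vecWedgeₗ_apply, wedge_vec,
      contract_one, mul_one, sub_zero, smul_mul_assoc]
  | add x y hx hy =>
    rw [add_mul, ← contractₗ_apply, map_add, contractₗ_apply, contractₗ_apply, hx, hy,
      ← add_mul, ← vecWedgeₗ_apply v (x + y), map_add]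
    rfl
  | ι_mul x w hx =>
    change contract v (vec w * x * _) = wedge (vec v) (vec w * x) * _
    have h : vec w * x = wedge (vec w) x + contract w x := by rw [wedge_vec]; abel
    have h3 : wedge (vec v) (vec w * x) = ⟪v, w⟫ • x - vec w * wedge (vec v) x := by
      rw [h, ← vecWedgeₗ_apply, map_add, vecWedgeₗ_apply, vecWedgeₗ_apply, wedge_wedge,
        wedge_vec w (wedge _ _), contract_wedge, real_inner_comm v w]
      abel
    rw [mul_assoc, contract_vec_mul, hx, h3, sub_mul, smul_mul_assoc, mul_assoc]

theorem wedge_mul_pseudoscalar (v : E N) (A : GA N) :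
    wedge (vec v) (A * pseudoscalar N) = contract v A * pseudoscalar N := by
  rw [wedge_vec, contract_mul_pseudoscalar, wedge_vec, sub_mul, mul_assoc]
  abel

/-! ### Directional derivatives along a set -/

section DirDeriv

variable {V W X : Type*} [NormedAddCommGroup V] [NormedSpace ℝ V] [NormedAddCommGroup W]
  [NormedSpace ℝ W] [NormedAddCommGroup X] [NormedSpace ℝ X] {M : Set (E N)} {x a : E N}

theorem hasDerivAt_bilinear [FiniteDimensional ℝ V] [FiniteDimensional ℝ W]
    (B : V →ₗ[ℝ] W →ₗ[ℝ] X) {f : ℝ → V} {g : ℝ → W} {f' : V} {g' : W} {t : ℝ}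
    (hf : HasDerivAt f f' t) (hg : HasDerivAt g g' t) :
    HasDerivAt (fun s => B (f s) (g s)) (B (f t) g' + B f' (g t)) t :=
  B.toContinuousBilinearMap.hasDerivAt_of_bilinear (fun _ => hf) (fun _ => hg)

theorem hasDerivAt_linear [FiniteDimensional ℝ V]
    (B : V →ₗ[ℝ] W) {f : ℝ → V} {f' : V} {t : ℝ}
    (hf : HasDerivAt f f' t) : HasDerivAt (fun s => B (f s)) (B f') t :=
  B.toContinuousLinearMap.hasFDerivAt.comp_hasDerivAt t hf

theorem HasDirDeriv.bilinear [FiniteDimensional ℝ V] [FiniteDimensional ℝ W]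
    (B : V →ₗ[ℝ] W →ₗ[ℝ] X) {F : E N → V} {G : E N → W} {F' : V} {G' : W}
    (hF : HasDirDeriv M F x a F') (hG : HasDirDeriv M G x a G') :
    HasDirDeriv M (fun y => B (F y) (G y)) x a (B (F x) G' + B F' (G x)) := by
  intro γ hγ
  have h := hasDerivAt_bilinear B (hF γ hγ) (hG γ hγ)
  rwa [hγ.1] at h

theorem HasDirDeriv.linear [FiniteDimensional ℝ V] (B : V →ₗ[ℝ] W) {F : E N → V} {F' : V}
    (hF : HasDirDeriv M F x a F') : HasDirDeriv M (fun y => B (F y)) x a (B F') :=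
  fun γ hγ => hasDerivAt_linear B (hF γ hγ)

theorem hasDirDeriv_const (c : V) : HasDirDeriv M (fun _ => c) x a 0 :=
  fun _ _ => hasDerivAt_const 0 c

theorem HasDirDeriv.congr {F G : E N → V} {L : V} (h : HasDirDeriv M F x a L)
    (hFG : ∀ y ∈ M, F y = G y) : HasDirDeriv M G x a L := fun γ hγ =>
  (h γ hγ).congr_of_eventuallyEq (hγ.2.1.mono fun _ ht => (hFG _ ht).symm)

/-- The directional derivative of the restriction of a differentiable function. -/
theorem hasDirDeriv_of_differentiableAt {F G : E N → V} {U : Set (E N)} (hU : U ∈ 𝓝 x)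
    (hG : DifferentiableAt ℝ G x) (h : ∀ y ∈ M ∩ U, F y = G y) :
    HasDirDeriv M F x a (fderiv ℝ G x a) := by
  intro γ hγ
  have h1 : HasDerivAt (fun t => G (γ t)) (fderiv ℝ G x a) 0 :=
    HasFDerivAt.comp_hasDerivAt 0 (by rw [hγ.1]; exact hG.hasFDerivAt) hγ.2.2
  have h2 : ∀ᶠ t in 𝓝 (0 : ℝ), γ t ∈ U :=
    hγ.2.2.continuousAt.eventually (by rw [hγ.1]; exact hU)
  refine h1.congr_of_eventuallyEq ?_
  filter_upwards [hγ.2.1, h2] with t ht ht'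
  exact h _ ⟨ht, ht'⟩

theorem HasDirDeriv.unique {F : E N → V} {L L' : V} (hc : ∃ γ, IsCurveIn M x a γ)
    (h : HasDirDeriv M F x a L) (h' : HasDirDeriv M F x a L') : L = L' := by
  obtain ⟨γ, hγ⟩ := hc
  exact (h γ hγ).unique (h' γ hγ)

theorem HasDirDeriv.hasDirDeriv_dirDeriv {F : E N → V} {L : V} (h : HasDirDeriv M F x a L) :
    HasDirDeriv M F x a (dirDeriv M F x a) := by
  have hL : ∃ L, HasDirDeriv M F x a L := ⟨L, h⟩
  rw [dirDeriv, dif_pos hL]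
  exact hL.choose_spec

theorem HasDirDeriv.dirDeriv_eq {F : E N → V} {L : V} (hc : ∃ γ, IsCurveIn M x a γ)
    (h : HasDirDeriv M F x a L) : dirDeriv M F x a = L :=
  h.hasDirDeriv_dirDeriv.unique hc h

end DirDeriv

/-! ### Linear algebra of orthogonal projections -/

section Projection

variable {F : Type*} [NormedAddCommGroup F] [InnerProductSpace ℝ F] [FiniteDimensional ℝ F]

/-- The trace of a bilinear map on a subspace, computed in an orthonormal basis of the subspace or of
the whole space. -/
theorem sum_orthonormalBasis_subspace {ι κ V : Type*} [Fintype ι] [Fintype κ] [AddCommGroup V]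
    [Module ℝ V] (K : Submodule ℝ F) (τ : OrthonormalBasis ι ℝ K) (e : OrthonormalBasis κ ℝ F)
    (β : F →ₗ[ℝ] F →ₗ[ℝ] V) :
    ∑ j, β (τ j) (τ j) = ∑ i, β (e i) (K.starProjection (e i)) := by
  have h1 : ∀ i, K.starProjection (e i) = ∑ j, ⟪(τ j : F), e i⟫ • (τ j : F) := fun i => by
    rw [Submodule.starProjection_apply, ← τ.sum_repr' (K.orthogonalProjectionOnto (e i))]
    simp only [Submodule.coe_sum, Submodule.coe_smul, Submodule.coe_inner]
    refine Finset.sum_congr rfl fun j _ => ?_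
    rw [← Submodule.starProjection_apply, ← Submodule.inner_starProjection_left_eq_right,
      Submodule.starProjection_eq_self_iff.2 (τ j).2]
  have h2 : ∀ j, (τ j : F) = ∑ i, ⟪(τ j : F), e i⟫ • e i := fun j => by
    conv_lhs => rw [← e.sum_repr' (τ j : F)]
    simp only [real_inner_comm]
  simp only [h1, map_sum, map_smul]
  rw [Finset.sum_comm]
  refine Finset.sum_congr rfl fun j _ => ?_
  conv_lhs => arg 1; rw [h2 j]
  simp only [map_sum, map_smul, LinearMap.sum_apply, LinearMap.smul_apply]

/-- The operator `Q A* A Q + (1 - Q)` attached to an operator `A` and a subspace `W` with orthogonal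
projection `Q`: the Gram operator of `A` on `W`, and the identity on the complement of `W`. -/
def gram (W : Submodule ℝ F) (A : F →L[ℝ] F) : F →L[ℝ] F :=
  W.starProjection * A.adjoint * A * W.starProjection + (1 - W.starProjection)

theorem isUnit_gram (W : Submodule ℝ F) {A : F →L[ℝ] F} (hA : Function.Injective A) :
    IsUnit (gram W A) := by
  rw [ContinuousLinearMap.isUnit_iff_isUnit_toLinearMap, LinearMap.isUnit_iff_ker_eq_bot,
    LinearMap.ker_eq_bot']
  intro v hv
  have hv' : gram W A v = 0 := hv
  have h1 : ⟪gram W A v, v⟫ = ‖A (W.starProjection v)‖ ^ 2 + ‖v - W.starProjection v‖ ^ 2 := by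
    have h2 : ⟪v - W.starProjection v, v⟫ = ‖v - W.starProjection v‖ ^ 2 := by
      rw [← real_inner_self_eq_norm_sq]
      conv_rhs => rw [inner_sub_right, W.starProjection_inner_eq_zero v _
        (W.starProjection_apply_mem v), sub_zero]
    have h3 : gram W A v =
        W.starProjection (A.adjoint (A (W.starProjection v))) + (v - W.starProjection v) := rfl
    rw [h3, inner_add_left, h2, Submodule.inner_starProjection_left_eq_right,
      ContinuousLinearMap.adjoint_inner_left, real_inner_self_eq_norm_sq]
  rw [hv', inner_zero_left] at h1
  have h3 : A (W.starProjection v) = 0 := by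
    rw [← norm_eq_zero, ← sq_eq_zero_iff]
    linarith [sq_nonneg ‖A (W.starProjection v)‖, sq_nonneg ‖v - W.starProjection v‖]
  have h4 : v - W.starProjection v = 0 := by
    rw [← norm_eq_zero, ← sq_eq_zero_iff]
    linarith [sq_nonneg ‖A (W.starProjection v)‖, sq_nonneg ‖v - W.starProjection v‖]
  have h5 : W.starProjection v = 0 := hA (by rw [h3, map_zero])
  rwa [h5, sub_zero] at h4

/-- The orthogonal projection onto the image of a subspace under an injective operator. -/
theorem starProjection_map (W : Submodule ℝ F) {A : F →L[ℝ] F} (hA : Function.Injective A) :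
    (W.map A.toLinearMap).starProjection =
      A * W.starProjection * Ring.inverse (gram W A) * W.starProjection * A.adjoint := by
  set Q := W.starProjection with hQ
  have hQQ : Q * Q = Q := W.isIdempotentElem_starProjection
  have hB := isUnit_gram W hA
  have h1 : Ring.inverse (gram W A) * (Q * A.adjoint * A * Q) = Q := by
    have : Q * A.adjoint * A * Q = gram W A * Q := by
      rw [gram, add_mul, sub_mul, one_mul, ← hQ, hQQ, sub_self, add_zero, mul_assoc _ Q Q, hQQ]
    rw [this, ← mul_assoc, Ring.inverse_mul_cancel _ hB, one_mul]
  have h2 : (Q * A.adjoint * A * Q) * Ring.inverse (gram W A) = Q := by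
    have : Q * A.adjoint * A * Q = Q * gram W A := by
      rw [gram, mul_add, mul_sub, mul_one, ← hQ, hQQ, sub_self, add_zero]
      simp only [← mul_assoc, hQQ]
    rw [this, mul_assoc, Ring.mul_inverse_cancel _ hB, mul_one]
  ext v
  refine Submodule.eq_starProjection_of_mem_of_inner_eq_zero ?_ ?_
  · exact ⟨Q ((Ring.inverse (gram W A) * Q * A.adjoint) v), W.starProjection_apply_mem _, rfl⟩
  · rintro _ ⟨w, hw, rfl⟩
    have h3 : A w = A (Q w) := by rw [hQ, Submodule.starProjection_eq_self_iff.2 hw]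
    have h4 : Q * A.adjoint * (A * Q * Ring.inverse (gram W A) * Q * A.adjoint) =
        Q * A.adjoint := by
      calc _ = (Q * A.adjoint * A * Q) * Ring.inverse (gram W A) * Q * A.adjoint := by
            simp only [mul_assoc]
        _ = _ := by rw [h2, hQQ]
    have h5 : Q (A.adjoint ((A * Q * Ring.inverse (gram W A) * Q * A.adjoint) v)) =
        Q (A.adjoint v) := congrArg (fun T : F →L[ℝ] F => T v) h4
    change ⟪_, A w⟫ = 0
    rw [h3, ← ContinuousLinearMap.adjoint_inner_left, ← Submodule.inner_starProjection_left_eq_right,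
      map_sub, map_sub, sub_eq_zero.2, inner_zero_left]
    exact h5.symm

theorem contDiff_adjoint {n : ℕ∞ω} :
    ContDiff ℝ n (fun A : F →L[ℝ] F => A.adjoint) :=
  let L : (F →L[ℝ] F) →ₗ[ℝ] (F →L[ℝ] F) :=
    { toFun := fun A => A.adjoint
      map_add' := fun A B => map_add _ A B
      map_smul' := fun c A => by simp }
  L.toContinuousLinearMap.contDiff

end Projection

/-! ### Tangent spaces in a straightening chart -/

/-- The subspace `ℝ^m × {0}` of `ℝ^N`. -/
def flatSubspace (N m : ℕ) : Submodule ℝ (E N) where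
  carrier := {v | ∀ i : Fin N, m ≤ (i : ℕ) → v i = 0}
  add_mem' hv hw i hi := by simp [hv i hi, hw i hi]
  zero_mem' i _ := rfl
  smul_mem' c v hv i hi := by simp [hv i hi]

/-- `Φ` is a smooth chart of `ℝ^N` that straightens `M` to `ℝ^m × {0}`. -/
structure IsStraightening (m : ℕ) (M : Set (E N)) (Φ : OpenPartialHomeomorph (E N) (E N)) :
    Prop where
  contDiffOn : ContDiffOn ℝ ∞ Φ Φ.source
  contDiffOn_symm : ContDiffOn ℝ ∞ Φ.symm Φ.target
  mem_iff : ∀ y ∈ Φ.source, (y ∈ M ↔ Φ y ∈ flatSubspace N m)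

theorem IsSmoothSubmanifold.exists_straightening {M : Set (E N)} (hM : IsSmoothSubmanifold m M)
    {x : E N} (hx : x ∈ M) : ∃ Φ, x ∈ Φ.source ∧ IsStraightening m M Φ := by
  obtain ⟨Φ, h1, h2, h3, h4⟩ := hM.2 x hx
  exact ⟨Φ, h1, h2, h3, h4⟩

/-- The differential at `Φ y` of the inverse of a chart `Φ`. -/
def chartDeriv (Φ : OpenPartialHomeomorph (E N) (E N)) (y : E N) : E N →L[ℝ] E N :=
  fderiv ℝ Φ.symm (Φ y)

namespace IsStraightening

variable {M : Set (E N)} {Φ : OpenPartialHomeomorph (E N) (E N)} {x y : E N}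

theorem contDiffAt_symm (h : IsStraightening m M Φ) (hy : y ∈ Φ.source) :
    ContDiffAt ℝ ∞ Φ.symm (Φ y) :=
  h.contDiffOn_symm.contDiffAt (Φ.open_target.mem_nhds (Φ.map_source hy))

theorem hasFDerivAt_symm (h : IsStraightening m M Φ) (hy : y ∈ Φ.source) :
    HasFDerivAt Φ.symm (chartDeriv Φ y) (Φ y) :=
  ((h.contDiffAt_symm hy).differentiableAt (by simp)).hasFDerivAt

theorem hasFDerivAt (h : IsStraightening m M Φ) (hy : y ∈ Φ.source) :
    HasFDerivAt Φ (fderiv ℝ Φ y) y :=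
  ((h.contDiffOn.contDiffAt (Φ.open_source.mem_nhds hy)).differentiableAt (by simp)).hasFDerivAt

theorem injective_chartDeriv (h : IsStraightening m M Φ) (hy : y ∈ Φ.source) :
    Function.Injective (chartDeriv Φ y) := by
  have h1 : HasFDerivAt (Φ ∘ Φ.symm) ((fderiv ℝ Φ y).comp (chartDeriv Φ y)) (Φ y) :=
    HasFDerivAt.comp (Φ y) (by rw [Φ.left_inv hy]; exact h.hasFDerivAt hy)
      (h.hasFDerivAt_symm hy)
  have h2 : HasFDerivAt (Φ ∘ Φ.symm) (ContinuousLinearMap.id ℝ (E N)) (Φ y) :=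
    (hasFDerivAt_id _).congr_of_eventuallyEq
      (Φ.eventually_right_inverse (Φ.map_source hy))
  have h3 := h1.unique h2
  exact Function.LeftInverse.injective (g := fderiv ℝ Φ y) fun v => congrArg (fun T => T v) h3

/-- The image under the inverse chart of a line in `ℝ^m × {0}` is a curve in `M`. -/
theorem isCurveIn (h : IsStraightening m M Φ) (hy : y ∈ Φ.source) (hyM : y ∈ M) {w : E N}
    (hw : w ∈ flatSubspace N m) :
    IsCurveIn M y (chartDeriv Φ y w) fun t => Φ.symm (Φ y + t • w) := by
  have h0 : HasDerivAt (fun t : ℝ => Φ y + t • w) w 0 := by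
    simpa using ((hasDerivAt_id (0 : ℝ)).smul_const w).const_add (Φ y)
  refine ⟨by simp [Φ.left_inv hy], ?_, ?_⟩
  · have h1 : ∀ᶠ t in 𝓝 (0 : ℝ), Φ y + t • w ∈ Φ.target :=
      h0.continuousAt.eventually (Φ.open_target.mem_nhds (by simpa using Φ.map_source hy))
    filter_upwards [h1] with t ht
    rw [h.mem_iff _ (Φ.map_target ht), Φ.right_inv ht]
    exact add_mem ((h.mem_iff y hy).1 hyM) (Submodule.smul_mem _ t hw)
  · exact HasFDerivAt.comp_hasDerivAt 0 (by simpa using h.hasFDerivAt_symm hy) h0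

theorem velocity_mem (h : IsStraightening m M Φ) (hy : y ∈ Φ.source) {a : E N} {γ : ℝ → E N}
    (hγ : IsCurveIn M y a γ) : a ∈ (flatSubspace N m).map (chartDeriv Φ y).toLinearMap := by
  have h1 : HasDerivAt (Φ ∘ γ) (fderiv ℝ Φ y a) 0 :=
    HasFDerivAt.comp_hasDerivAt 0 (by rw [hγ.1]; exact h.hasFDerivAt hy) hγ.2.2
  have h2 : ∀ᶠ t in 𝓝 (0 : ℝ), γ t ∈ Φ.source :=
    hγ.2.2.continuousAt.eventually (by rw [hγ.1]; exact Φ.open_source.mem_nhds hy)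
  have h3 : HasDerivAt (Φ.symm ∘ Φ ∘ γ) (chartDeriv Φ y (fderiv ℝ Φ y a)) 0 :=
    HasFDerivAt.comp_hasDerivAt 0 (by simpa [hγ.1] using h.hasFDerivAt_symm hy) h1
  refine ⟨fderiv ℝ Φ y a, fun i hi => ?_, ?_⟩
  · have h4 : HasDerivAt (fun t => (Φ (γ t)) i) (fderiv ℝ Φ y a i) 0 :=
      (EuclideanSpace.proj i : E N →L[ℝ] ℝ).hasFDerivAt.comp_hasDerivAt 0 h1
    refine h4.unique ((hasDerivAt_const (0 : ℝ) (0 : ℝ)).congr_of_eventuallyEq ?_)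
    filter_upwards [h2, hγ.2.1] with t ht htM
    exact (h.mem_iff _ ht).1 htM i hi
  · refine h3.unique (hγ.2.2.congr_of_eventuallyEq ?_)
    filter_upwards [h2] with t ht
    exact Φ.left_inv ht

theorem tangentSpace_eq (h : IsStraightening m M Φ) (hy : y ∈ Φ.source) (hyM : y ∈ M) :
    tangentSpace M y = (flatSubspace N m).map (chartDeriv Φ y).toLinearMap := by
  apply le_antisymm
  · rw [tangentSpace, Submodule.span_le]
    rintro a ⟨γ, hγ⟩
    exact h.velocity_mem hy hγ
  · rintro _ ⟨w, hw, rfl⟩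
    exact Submodule.subset_span ⟨_, h.isCurveIn hy hyM hw⟩

theorem contDiffOn_chartDeriv (h : IsStraightening m M Φ) :
    ContDiffOn ℝ ∞ (chartDeriv Φ) Φ.source :=
  (h.contDiffOn_symm.fderiv_of_isOpen Φ.open_target (m := ∞) (by simp)).comp h.contDiffOn
    fun _ hy => Φ.map_source hy

end IsStraightening

/-! ### Smoothness of the tangent projection -/

/-- The orthogonal projection onto the tangent space at `y`. -/
def tangentProj (M : Set (E N)) (y : E N) : E N →L[ℝ] E N := (tangentSpace M y).starProjection

variable {M : Set (E N)} {x a b : E N}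

theorem IsSmoothSubmanifold.exists_contDiffOn_tangentProj (hM : IsSmoothSubmanifold m M)
    (hx : x ∈ M) : ∃ (U : Set (E N)) (P : E N → E N →L[ℝ] E N), IsOpen U ∧ x ∈ U ∧
      ContDiffOn ℝ ∞ P U ∧ ∀ y ∈ M ∩ U, tangentProj M y = P y := by
  obtain ⟨Φ, hxΦ, h⟩ := hM.exists_straightening hx
  set A := chartDeriv Φ with hA
  set Q := (flatSubspace N m).starProjection with hQ
  refine ⟨Φ.source, fun y => A y * Q * Ring.inverse (gram (flatSubspace N m) (A y)) * Q *
    (A y).adjoint, Φ.open_source, hxΦ, ?_, fun y hy => ?_⟩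
  · have h1 : ContDiffOn ℝ ∞ A Φ.source := h.contDiffOn_chartDeriv
    have h2 : ContDiffOn ℝ ∞ (fun y => (A y).adjoint) Φ.source :=
      contDiff_adjoint.comp_contDiffOn h1
    have h3 : ContDiffOn ℝ ∞ (fun y => gram (flatSubspace N m) (A y)) Φ.source := by
      have := (((contDiffOn_const (c := Q)).mul h2).mul h1).mul (contDiffOn_const (c := Q))
      exact this.add contDiffOn_const
    have h4 : ContDiffOn ℝ ∞ (fun y => Ring.inverse (gram (flatSubspace N m) (A y)))
        Φ.source := by
      intro y hy
      obtain ⟨u, hu⟩ := isUnit_gram (flatSubspace N m) (h.injective_chartDeriv hy)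
      have h5 := contDiffAt_ringInverse ℝ (n := ∞) u
      rw [hu] at h5
      exact h5.comp_contDiffWithinAt y (h3 y hy)
    exact (((h1.mul contDiffOn_const).mul h4).mul contDiffOn_const).mul h2
  · simp only [tangentProj, h.tangentSpace_eq hy.2 hy.1]
    rw [starProjection_map _ (h.injective_chartDeriv hy.2)]

theorem IsSmoothSubmanifold.exists_curve (hM : IsSmoothSubmanifold m M) (hx : x ∈ M)
    (ha : a ∈ tangentSpace M x) : ∃ γ, IsCurveIn M x a γ := by
  obtain ⟨Φ, hxΦ, h⟩ := hM.exists_straightening hx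
  rw [h.tangentSpace_eq hxΦ hx] at ha
  obtain ⟨w, hw, rfl⟩ := ha
  exact ⟨_, h.isCurveIn hxΦ hx hw⟩

/-! ### The second fundamental form -/

/-- The derivative of the tangent projection in the direction `a`. For `a`, `b` tangent at `x` its
value at `b` is the second fundamental form. -/
def projDeriv (M : Set (E N)) (x a : E N) : E N →L[ℝ] E N := dirDeriv M (tangentProj M) x a

theorem tangentProj_of_mem (hb : b ∈ tangentSpace M x) : tangentProj M x b = b :=
  Submodule.starProjection_eq_self_iff.2 hb

theorem IsSmoothSubmanifold.hasDirDeriv_tangentProj (hM : IsSmoothSubmanifold m M) (hx : x ∈ M) :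
    HasDirDeriv M (tangentProj M) x a (projDeriv M x a) := by
  obtain ⟨U, P, hU, hxU, hP, h⟩ := hM.exists_contDiffOn_tangentProj hx
  exact (hasDirDeriv_of_differentiableAt (hU.mem_nhds hxU)
    ((hP.contDiffAt (hU.mem_nhds hxU)).differentiableAt (by simp)) h).hasDirDeriv_dirDeriv

/-- Evaluation of operators as a bilinear map. -/
def applyₗ (N : ℕ) : (E N →L[ℝ] E N) →ₗ[ℝ] E N →ₗ[ℝ] E N := ContinuousLinearMap.coeLM ℝ

theorem IsSmoothSubmanifold.hasDirDeriv_tangentProj_apply (hM : IsSmoothSubmanifold m M)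
    (hx : x ∈ M) {F : E N → E N} {L : E N} (hF : HasDirDeriv M F x a L) :
    HasDirDeriv M (fun y => tangentProj M y (F y)) x a
      (tangentProj M x L + projDeriv M x a (F x)) :=
  (hM.hasDirDeriv_tangentProj hx).bilinear (applyₗ N) hF

theorem IsSmoothSubmanifold.hasDirDeriv_tangentialField (hM : IsSmoothSubmanifold m M)
    (hx : x ∈ M) : HasDirDeriv M (tangentialField M b) x a (projDeriv M x a b) := by
  have h := hM.hasDirDeriv_tangentProj_apply (a := a) hx (hasDirDeriv_const b)
  rw [map_zero, zero_add] at h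
  exact h

theorem IsSmoothSubmanifold.inner_projDeriv (hM : IsSmoothSubmanifold m M) (hx : x ∈ M)
    (ha : a ∈ tangentSpace M x) (v w : E N) :
    ⟪projDeriv M x a v, w⟫ = ⟪v, projDeriv M x a w⟫ := by
  have h1 := (hM.hasDirDeriv_tangentialField (a := a) (b := v) hx).linear ((innerₗ (E N)).flip w)
  have h2 := (hM.hasDirDeriv_tangentialField (a := a) (b := w) hx).linear (innerₗ (E N) v)
  refine h1.unique (hM.exists_curve hx ha) (h2.congr fun y _ => ?_)
  exact ((tangentSpace M y).inner_starProjection_left_eq_right v w).symm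

/-- The second fundamental form takes its values in the normal space. -/
theorem IsSmoothSubmanifold.tangentProj_projDeriv (hM : IsSmoothSubmanifold m M) (hx : x ∈ M)
    (ha : a ∈ tangentSpace M x) (hb : b ∈ tangentSpace M x) :
    tangentProj M x (projDeriv M x a b) = 0 := by
  have h1 := hM.hasDirDeriv_tangentialField (a := a) (b := b) hx
  have h2 := hM.hasDirDeriv_tangentProj_apply hx h1
  have h3 : projDeriv M x a b =
      tangentProj M x (projDeriv M x a b) + projDeriv M x a (tangentialField M b x) := by
    refine h1.unique (hM.exists_curve hx ha) (h2.congr fun y _ => ?_)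
    exact Submodule.starProjection_eq_self_iff.2 (Submodule.starProjection_apply_mem _ _)
  have h4 : tangentialField M b x = b := tangentProj_of_mem hb
  rw [h4] at h3
  simpa using h3

/-- The second fundamental form is symmetric, because second derivatives of a parametrization
are. -/
theorem IsSmoothSubmanifold.projDeriv_symm (hM : IsSmoothSubmanifold m M) (hx : x ∈ M)
    (ha : a ∈ tangentSpace M x) (hb : b ∈ tangentSpace M x) :
    projDeriv M x a b = projDeriv M x b a := by
  obtain ⟨Φ, hxΦ, h⟩ := hM.exists_straightening hx
  rw [h.tangentSpace_eq hxΦ hx] at ha hb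
  obtain ⟨v, hv, rfl⟩ := ha
  obtain ⟨w, hw, rfl⟩ := hb
  set D := fderiv ℝ (fderiv ℝ Φ.symm) (Φ x) with hD
  have hsymm : D v w = D w v := (h.contDiffAt_symm hxΦ).isSymmSndFDerivAt
    (by rw [minSmoothness_of_isRCLikeNormedField]; exact ENat.LEInfty.out) v w
  have key : ∀ {v w : E N}, v ∈ flatSubspace N m → w ∈ flatSubspace N m →
      projDeriv M x (chartDeriv Φ x v) (chartDeriv Φ x w) = D v w - tangentProj M x (D v w) := by
    intro v w hv hw
    have hγ := h.isCurveIn hxΦ hx hv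
    set γ : ℝ → E N := fun t => Φ.symm (Φ x + t • v) with hγdef
    have h0 : HasDerivAt (fun t : ℝ => Φ x + t • v) v 0 := by
      simpa using ((hasDerivAt_id (0 : ℝ)).smul_const v).const_add (Φ x)
    have htar : ∀ᶠ t in 𝓝 (0 : ℝ), Φ x + t • v ∈ Φ.target :=
      h0.continuousAt.eventually (Φ.open_target.mem_nhds (by simpa using Φ.map_source hxΦ))
    -- the coordinate field `y ↦ (chartDeriv Φ y) w` is tangent, and its derivative along `γ` is
    -- a second derivative of the parametrization
    have h1 : HasDerivAt (fun t : ℝ => fderiv ℝ Φ.symm (Φ x + t • v) w) (D v w) 0 := by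
      have h2 : ContDiffAt ℝ 1 (fderiv ℝ Φ.symm) (Φ x + (0 : ℝ) • v) := by
        rw [zero_smul, add_zero]
        exact (h.contDiffAt_symm hxΦ).fderiv_right
          (by rw [one_add_one_eq_two]; exact ENat.LEInfty.out)
      have h3 := (h2.differentiableAt one_ne_zero).hasFDerivAt.comp_hasDerivAt 0 h0
      rw [zero_smul, add_zero] at h3
      exact hasDerivAt_linear (V := E N →L[ℝ] E N) ((applyₗ N).flip w) h3
    have h3 : HasDerivAt (fun t : ℝ => tangentProj M (γ t) (fderiv ℝ Φ.symm (Φ x + t • v) w))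
        (tangentProj M (γ 0) (D v w) + projDeriv M x (chartDeriv Φ x v)
          (fderiv ℝ Φ.symm (Φ x + (0 : ℝ) • v) w)) 0 :=
      hasDerivAt_bilinear (applyₗ N) (hM.hasDirDeriv_tangentProj hx γ hγ) h1
    have h4 : γ 0 = x := hγ.1
    rw [h4, zero_smul, add_zero] at h3
    have h5 := h3.unique (h1.congr_of_eventuallyEq ?_)
    · exact eq_sub_of_add_eq' h5
    · filter_upwards [htar, hγ.2.1] with t ht htM
      apply tangentProj_of_mem
      rw [h.tangentSpace_eq (Φ.map_target ht) htM]
      exact ⟨w, hw, by simp [chartDeriv, Φ.right_inv ht]⟩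
  exact (key hv hw).trans ((congrArg (fun u => u - tangentProj M x u) hsymm).trans
    (key hw hv).symm)

theorem IsSmoothSubmanifold.secondFundamentalForm_eq (hM : IsSmoothSubmanifold m M) (hx : x ∈ M)
    (ha : a ∈ tangentSpace M x) (hb : b ∈ tangentSpace M x) :
    secondFundamentalForm M x a b = projDeriv M x a b := by
  rw [secondFundamentalForm,
    (hM.hasDirDeriv_tangentialField hx).dirDeriv_eq (hM.exists_curve hx ha),
    Submodule.starProjection_orthogonal_val]
  exact sub_eq_self.2 (hM.tangentProj_projDeriv hx ha hb)

theorem IsSmoothSubmanifold.meanCurvature_eq (hM : IsSmoothSubmanifold m M) (hx : x ∈ M) :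
    meanCurvature M x = ∑ j, projDeriv M x (frame M x j) (frame M x j) :=
  Finset.sum_congr rfl fun j _ =>
    hM.secondFundamentalForm_eq hx (frame M x j).2 (frame M x j).2

theorem IsSmoothSubmanifold.tangentProj_meanCurvature (hM : IsSmoothSubmanifold m M)
    (hx : x ∈ M) : tangentProj M x (meanCurvature M x) = 0 := by
  rw [hM.meanCurvature_eq hx, map_sum]
  exact Finset.sum_eq_zero fun j _ =>
    hM.tangentProj_projDeriv hx (frame M x j).2 (frame M x j).2

/-- The mean curvature vector is differentiable: it is locally the trace of the derivative of a
smooth extension of the tangent projection. -/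
theorem IsSmoothSubmanifold.dirDifferentiable_meanCurvature (hM : IsSmoothSubmanifold m M) :
    DirDifferentiable M (meanCurvature M) := by
  intro x hx a _
  obtain ⟨U, P, hU, hxU, hP, h⟩ := hM.exists_contDiffOn_tangentProj hx
  have hP' : ContDiffOn ℝ ∞ (fderiv ℝ P) U := hP.fderiv_of_isOpen hU (by simp)
  let e := EuclideanSpace.basisFun (Fin N) ℝ
  let G : E N → E N := fun y => ∑ i, fderiv ℝ P y (P y (e i)) (e i)
  have hG : ContDiffOn ℝ ∞ G U := ContDiffOn.sum fun i _ =>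
    (hP'.clm_apply (hP.clm_apply contDiffOn_const)).clm_apply contDiffOn_const
  refine ⟨_, hasDirDeriv_of_differentiableAt (hU.mem_nhds hxU)
    ((hG.contDiffAt (hU.mem_nhds hxU)).differentiableAt (by simp)) fun y hy => ?_⟩
  have h1 : ∀ j, projDeriv M y (frame M y j) = fderiv ℝ P y (frame M y j) := fun j =>
    (hasDirDeriv_of_differentiableAt (hU.mem_nhds hy.2)
      ((hP.contDiffAt (hU.mem_nhds hy.2)).differentiableAt (by simp)) h).dirDeriv_eq
      (hM.exists_curve hy.1 (frame M y j).2)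
  rw [hM.meanCurvature_eq hy.1]
  simp only [h1]
  refine (sum_orthonormalBasis_subspace _ (frame M y) e
    ((applyₗ N).comp (fderiv ℝ P y).toLinearMap).flip).trans ?_
  change ∑ i, fderiv ℝ P y (tangentProj M y (e i)) (e i) = _
  rw [h y hy]

variable {T : E N → GA N}

/-! ### Derivative of blades -/

instance instFiniteDimensionalGA (N : ℕ) : FiniteDimensional ℝ (GA N) :=
  Module.Basis.finiteDimensional_of_finite (stdBasisGA N)

/-- If the factors of a blade have derivatives given by a linear map `L`, the derivative of the blade
is given by the derivation `∑ⱼ L fⱼ ∧ (fⱼ ⌟ ·)` that extends `L` to multivectors. It suffices that the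
vectors `fⱼ` resolve the factors as an orthonormal basis does. -/
theorem hasDerivAt_blade {ι : Type*} [Fintype ι] (f : ι → E N) (L : E N →ₗ[ℝ] E N) {t : ℝ} :
    ∀ {m : ℕ} (v : ℝ → Fin m → E N), (∀ k, v t k = ∑ j, ⟪f j, v t k⟫ • f j) →
      (∀ k, HasDerivAt (fun s => v s k) (L (v t k)) t) →
      HasDerivAt (fun s => blade (v s))
        (∑ j, wedge (vec (L (f j))) (contract (f j) (blade (v t)))) t
  | 0, v, _, _ => by
    simp only [blade_zero, contract_one, ← vecWedgeₗ_apply, map_zero, Finset.sum_const_zero]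
    exact hasDerivAt_const _ _
  | m + 1, v, hf, hv => by
    have ih := hasDerivAt_blade f L (fun s k => v s k.succ) (fun k => hf k.succ)
      fun k => hv k.succ
    have h := hasDerivAt_bilinear (vecWedgeₗ N) (hv 0) ih
    simp only [vecWedgeₗ_apply, ← blade_succ] at h
    refine h.congr_deriv ?_
    have h1 : wedge (vec (L (v t 0))) (blade fun k => v t k.succ) =
        ∑ j, ⟪f j, v t 0⟫ • wedge (vec (L (f j))) (blade fun k => v t k.succ) := by
      change vecWedgeₗ N (L (v t 0)) _ = ∑ j, ⟪f j, v t 0⟫ • vecWedgeₗ N (L (f j)) _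
      conv_lhs => rw [hf 0]
      simp only [map_sum, map_smul, LinearMap.sum_apply, LinearMap.smul_apply]
    have h2 : wedge (vec (v t 0)) (∑ j, wedge (vec (L (f j)))
          (contract (f j) (blade fun k => v t k.succ))) =
        ∑ j, wedge (vec (v t 0)) (wedge (vec (L (f j)))
          (contract (f j) (blade fun k => v t k.succ))) := by
      simp only [← vecWedgeₗ_apply, map_sum]
    rw [h1, h2, ← Finset.sum_add_distrib]
    refine Finset.sum_congr rfl fun j _ => ?_
    rw [blade_succ, contract_wedge, wedge_wedge (v t 0), ← vecWedgeₗ_apply (L (f j)) (_ - _),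
      map_sub, map_smul, vecWedgeₗ_apply, vecWedgeₗ_apply]
    abel

/-- The blades with `m` factors in a subspace of dimension `m` form a line, since an alternating map
is determined by its value on a basis. -/
theorem exists_blade_eq_smul (K : Submodule ℝ (E N)) (τ : OrthonormalBasis (Fin m) ℝ K)
    (v : Fin m → E N) (hv : ∀ k, v k ∈ K) :
    ∃ c : ℝ, blade v = c • blade (fun j => (τ j : E N)) := by
  let f : K [⋀^Fin m]→ₗ[ℝ] ExteriorAlgebra ℝ (E N) :=
    (ExteriorAlgebra.ιMulti ℝ m).compLinearMap K.subtype
  let g : K [⋀^Fin m]→ₗ[ℝ] ExteriorAlgebra ℝ (E N) :=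
    (LinearMap.toSpanSingleton ℝ _ (f τ)).compAlternatingMap τ.toBasis.det
  have hfg : f = g := by
    refine Module.Basis.ext_alternating τ.toBasis fun σ hσ => ?_
    let π : Equiv.Perm (Fin m) := Equiv.ofBijective σ (Finite.injective_iff_bijective.1 hσ)
    change f (τ.toBasis ∘ π) = g (τ.toBasis ∘ π)
    rw [AlternatingMap.map_perm, AlternatingMap.map_perm]
    congr 1
    rw [LinearMap.compAlternatingMap_apply, Module.Basis.det_self,
      LinearMap.toSpanSingleton_apply, one_smul, OrthonormalBasis.coe_toBasis]
  refine ⟨τ.toBasis.det fun k => ⟨v k, hv k⟩, ?_⟩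
  have h := congrArg (fun h => h fun k => (⟨v k, hv k⟩ : K)) hfg
  rw [blade, blade, ← map_smul]
  exact congrArg _ h

/-! ### Algebraic properties of the Gauss map -/

theorem orthonormal_coe {K : Submodule ℝ (E N)} (τ : OrthonormalBasis (Fin m) ℝ K) :
    Orthonormal ℝ fun j => (τ j : E N) :=
  τ.orthonormal.comp_linearIsometry K.subtypeₗᵢ

namespace IsGaussMap

theorem reverse_mul_self (hT : IsGaussMap m M T) (hx : x ∈ M) :
    CliffordAlgebra.reverse (T x) * T x = 1 := by
  obtain ⟨τ, h | h⟩ := hT.2 x hx <;> rw [h]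
  · exact reverse_blade_mul_blade _ (orthonormal_coe τ)
  · rw [map_neg, neg_mul_neg]
    exact reverse_blade_mul_blade _ (orthonormal_coe τ)

theorem contract_of_normal (hT : IsGaussMap m M T) (hx : x ∈ M) {w : E N}
    (hw : tangentProj M x w = 0) : contract w (T x) = 0 := by
  obtain ⟨τ, h⟩ := hT.2 x hx
  have h1 : contract w (blade fun j => (τ j : E N)) = 0 :=
    contract_blade_of_orthogonal _ _ fun j => by
      rw [← tangentProj_of_mem (τ j).2, tangentProj,
        ← Submodule.inner_starProjection_left_eq_right]
      exact (congrArg (fun u => ⟪u, (τ j : E N)⟫) hw).trans (inner_zero_left _)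
  rcases h with h | h <;> rw [h]
  · exact h1
  · rw [← contractₗ_apply, map_neg, contractₗ_apply, h1, neg_zero]

theorem wedge_of_tangent (hT : IsGaussMap m M T) (hx : x ∈ M)
    (ha : a ∈ tangentSpace M x) : wedge (vec a) (T x) = 0 := by
  obtain ⟨τ, h⟩ := hT.2 x hx
  have h1 : wedge (vec a) (blade fun j => (τ j : E N)) = 0 := by
    apply wedge_blade_of_mem_span
    have h2 := congrArg Subtype.val (τ.sum_repr ⟨a, ha⟩)
    rw [Submodule.coe_sum] at h2
    rw [show a = _ from h2.symm]
    exact Submodule.sum_mem _ fun j _ =>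
      Submodule.smul_mem _ _ (Submodule.subset_span ⟨j, rfl⟩)
  rcases h with h | h <;> rw [h]
  · exact h1
  · rw [← vecWedgeₗ_apply, map_neg, vecWedgeₗ_apply, h1, neg_zero]

theorem exists_blade_eq_smul (hT : IsGaussMap m M T) (hx : x ∈ M) (v : Fin m → E N)
    (hv : ∀ k, v k ∈ tangentSpace M x) : ∃ c : ℝ, blade v = c • T x := by
  obtain ⟨τ, h⟩ := hT.2 x hx
  obtain ⟨c, hc⟩ := GeomCalc.exists_blade_eq_smul _ τ v hv
  rcases h with h | h
  · exact ⟨c, by rw [h, hc]⟩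
  · exact ⟨-c, by rw [h, hc, neg_smul_neg]⟩

end IsGaussMap

theorem sum_inner_frame_smul (hb : b ∈ tangentSpace M x) :
    b = ∑ j, ⟪(frame M x j : E N), b⟫ • (frame M x j : E N) := by
  have h2 := congrArg Subtype.val ((frame M x).sum_repr' ⟨b, hb⟩)
  rw [Submodule.coe_sum] at h2
  exact h2.symm

/-! ### Derivative of the Gauss map -/

/-- The derivation `∑ⱼ II(a, τⱼ) ∧ (τⱼ ⌟ ·)` of multivectors, for an orthonormal basis `τ` of the
tangent space at `x`. -/
def shapeDerivation (M : Set (E N)) (x a : E N) (B : GA N) : GA N :=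
  ∑ j, wedge (vec (projDeriv M x a (frame M x j))) (contract (frame M x j : E N) B)

theorem inner_projDeriv_frame (hM : IsSmoothSubmanifold m M) (hx : x ∈ M)
    (ha : a ∈ tangentSpace M x) (hb : b ∈ tangentSpace M x) {c : E N}
    (hc : c ∈ tangentSpace M x) : ⟪projDeriv M x a b, c⟫ = 0 := by
  rw [← tangentProj_of_mem hc, tangentProj, ← Submodule.inner_starProjection_left_eq_right]
  exact (congrArg (fun u => ⟪u, c⟫) (hM.tangentProj_projDeriv hx ha hb)).trans
    (inner_zero_left _)

/-- On the tangent blade the derivation is left multiplication by a sum of products of orthogonal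
vectors, which is antisymmetric under reversion. -/
theorem exists_shapeDerivation_eq_mul (hM : IsSmoothSubmanifold m M) (hT : IsGaussMap m M T)
    (hx : x ∈ M) (ha : a ∈ tangentSpace M x) :
    ∃ S : GA N, shapeDerivation M x a (T x) = S * T x ∧ CliffordAlgebra.reverse S = -S := by
  refine ⟨∑ j, vec (projDeriv M x a (frame M x j)) * vec (frame M x j : E N), ?_, ?_⟩
  · rw [shapeDerivation, Finset.sum_mul]
    refine Finset.sum_congr rfl fun j _ => ?_
    have h1 := hT.wedge_of_tangent hx (frame M x j).2
    rw [wedge_vec, sub_eq_zero] at h1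
    rw [wedge_vec, contract_contract, hT.contract_of_normal hx
      (hM.tangentProj_projDeriv hx ha (frame M x j).2), ← contractₗ_apply _ 0, map_zero, neg_zero,
      sub_zero, ← h1, mul_assoc]
  · rw [map_sum, ← Finset.sum_neg_distrib]
    refine Finset.sum_congr rfl fun j _ => ?_
    rw [reverse_vec_mul, vec, CliffordAlgebra.reverse_ι]
    exact vec_mul_vec_of_orthogonal (by
      rw [real_inner_comm]
      exact inner_projDeriv_frame hM hx ha (frame M x j).2 (frame M x j).2)

/-- The bilinear map `(A, B) ↦ Aᵗ B`. -/
def reverseMulₗ (N : ℕ) : GA N →ₗ[ℝ] GA N →ₗ[ℝ] GA N :=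
  (LinearMap.mul ℝ (GA N)).comp CliffordAlgebra.reverse

theorem reverseMulₗ_apply (A B : GA N) : reverseMulₗ N A B = CliffordAlgebra.reverse A * B := rfl

/-- The derivative of the Gauss map. Near `x` the Gauss map is, up to a sign, the normalization of the
blade of the projections to the tangent spaces of an orthonormal basis of the tangent space at `x`;
the sign is constant by continuity, and the normalizing factor has derivative zero at `x`. -/
theorem hasDirDeriv_gaussMap (hM : IsSmoothSubmanifold m M) (hT : IsGaussMap m M T)
    (hx : x ∈ M) (ha : a ∈ tangentSpace M x) :
    HasDirDeriv M T x a (shapeDerivation M x a (T x)) := by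
  intro γ hγ
  obtain ⟨S, hS, hSrev⟩ := exists_shapeDerivation_eq_mul hM hT hx ha
  obtain ⟨τ, hτ⟩ := hT.2 x hx
  obtain ⟨s, hs, hsT⟩ : ∃ s : ℝ, s * s = 1 ∧ blade (fun j => (τ j : E N)) = s • T x := by
    rcases hτ with h | h
    · exact ⟨1, by simp, by rw [h, one_smul]⟩
    · exact ⟨-1, by simp, by rw [h, neg_smul_neg, one_smul]⟩
  obtain ⟨φ, hφ⟩ := SeparatingDual.exists_eq_one (R := ℝ) (one_ne_zero : (1 : GA N) ≠ 0)
  set v : ℝ → Fin m → E N := fun t k => tangentProj M (γ t) (τ k) with hv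
  set G : ℝ → GA N := fun t => blade (v t) with hG
  have hv0 : ∀ k, v 0 k = τ k := fun k => by
    rw [hv]; dsimp only; rw [hγ.1, tangentProj_of_mem (τ k).2]
  have hG0 : G 0 = s • T x := by
    rw [← hsT, hG]; dsimp only; congr 1; exact funext hv0
  have hGd : HasDerivAt G (s • (S * T x)) 0 := by
    have h := hasDerivAt_blade (fun j => (frame M x j : E N)) (projDeriv M x a).toLinearMap v
      (t := 0) (fun k => by rw [hv0]; exact sum_inner_frame_smul (τ k).2) fun k => by
        rw [hv0]; exact hM.hasDirDeriv_tangentialField hx γ hγ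
    refine h.congr_deriv (Eq.symm ?_)
    rw [← hS, shapeDerivation, Finset.smul_sum]
    refine Finset.sum_congr rfl fun j _ => ?_
    rw [show blade (v 0) = s • T x from hG0, ← contractₗ_apply _ (s • T x), map_smul,
      ← vecWedgeₗ_apply, ← vecWedgeₗ_apply, map_smul]
    rfl
  set q : ℝ → ℝ := fun t => φ (CliffordAlgebra.reverse (G t) * G t) with hq
  have hq0 : q 0 = 1 := by
    rw [hq]; dsimp only
    rw [hG0, map_smul, smul_mul_smul_comm, hs, one_smul, hT.reverse_mul_self hx, hφ]
  have hqd : HasDerivAt q 0 0 := by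
    have h := hasDerivAt_linear φ.toLinearMap (hasDerivAt_bilinear (reverseMulₗ N) hGd hGd)
    refine h.congr_deriv ?_
    rw [reverseMulₗ_apply, reverseMulₗ_apply, hG0, map_smul, map_smul,
      CliffordAlgebra.reverse.map_mul, hSrev]
    simp [mul_assoc]
  -- the proportionality factor between `G` and `T` along the curve
  set c : ℝ → ℝ := fun t => φ (CliffordAlgebra.reverse (T (γ t)) * G t) with hc
  have hTc : ContinuousAt (fun t => T (γ t)) 0 := by
    have h1 : Filter.Tendsto γ (𝓝 0) (𝓝[M] x) := tendsto_nhdsWithin_iff.2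
      ⟨by have := hγ.2.2.continuousAt.tendsto; rwa [hγ.1] at this, hγ.2.1⟩
    have h2 := (hT.1 x hx).tendsto.comp h1
    rw [ContinuousAt, hγ.1]
    exact h2
  have hcc : ContinuousAt (fun t => s * c t) 0 := by
    have h1 := (reverseMulₗ N).toContinuousBilinearMap.continuous₂.continuousAt.comp
      (hTc.prodMk hGd.continuousAt)
    exact (φ.continuous.continuousAt.comp h1).const_mul s
  have hc0 : s * c 0 = 1 := by
    rw [hc]; dsimp only
    rw [hG0, hγ.1, mul_smul_comm, hT.reverse_mul_self hx, map_smul, hφ, smul_eq_mul, mul_one, hs]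
  have hpos : ∀ᶠ t in 𝓝 (0 : ℝ), 0 < s * c t :=
    hcc.eventually (lt_mem_nhds (by dsimp only; rw [hc0]; exact one_pos))
  have hev : ∀ᶠ t in 𝓝 (0 : ℝ), T (γ t) = (s * (√(q t))⁻¹) • G t := by
    filter_upwards [hpos, hγ.2.1] with t ht htM
    obtain ⟨d, hd⟩ := hT.exists_blade_eq_smul htM (v t) fun k =>
      Submodule.starProjection_apply_mem _ _
    have hGt : G t = d • T (γ t) := hd
    have h1 : c t = d := by
      rw [hc]; dsimp only
      rw [hGt, mul_smul_comm, hT.reverse_mul_self htM, map_smul, hφ, smul_eq_mul, mul_one]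
    have h2 : q t = (s * c t) ^ 2 := by
      rw [hq]; dsimp only
      rw [hGt, map_smul, smul_mul_smul_comm, hT.reverse_mul_self htM, map_smul, hφ, smul_eq_mul, h1]
      linear_combination -(d * d) * hs
    have h3 : s * (s * c t)⁻¹ * d = 1 := by
      have hne := ht.ne'
      rw [h1] at hne ⊢
      have hd0 : d ≠ 0 := right_ne_zero_of_mul hne
      have hs0 : s ≠ 0 := left_ne_zero_of_mul hne
      field_simp
    rw [h2, Real.sqrt_sq ht.le, hGt, smul_smul, h3, one_smul]
  have hsq : HasDerivAt (fun t => s * (√(q t))⁻¹) 0 0 := by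
    have h1 := (hqd.sqrt (by rw [hq0]; exact one_ne_zero)).inv
      (by rw [hq0, Real.sqrt_one]; exact one_ne_zero)
    simpa using h1.const_mul s
  have hfin := (hsq.smul hGd).congr_of_eventuallyEq hev
  refine hfin.congr_deriv ?_
  rw [hS, zero_smul, add_zero, hq0, Real.sqrt_one, inv_one, mul_one, smul_smul, hs, one_smul]

/-! ### Operators on functions that agree on the submanifold -/

section Congr

variable {V : Type*} [NormedAddCommGroup V] [NormedSpace ℝ V]

open Classical in
theorem dirDeriv_congr {F G : E N → V} (h : ∀ y ∈ M, F y = G y) :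
    dirDeriv M F x a = dirDeriv M G x a := by
  have h1 : HasDirDeriv M F x a = HasDirDeriv M G x a := funext fun L => propext
    ⟨fun hF => hF.congr h, fun hG => hG.congr fun y hy => (h y hy).symm⟩
  have h2 : ∀ P Q : V → Prop, P = Q → (if h : ∃ L, P L then h.choose else 0) =
      if h : ∃ L, Q L then h.choose else 0 := by
    rintro P _ rfl
    rfl
  exact h2 _ _ h1

theorem DirDifferentiable.congr {F G : E N → V} (hF : DirDifferentiable M F)
    (h : ∀ y ∈ M, F y = G y) : DirDifferentiable M G := fun x hx a ha =>
  let ⟨L, hL⟩ := hF x hx a ha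
  ⟨L, hL.congr h⟩

theorem DirDifferentiable.hasDirDeriv {F : E N → V} (hF : DirDifferentiable M F) (hx : x ∈ M)
    (ha : a ∈ tangentSpace M x) : HasDirDeriv M F x a (dirDeriv M F x a) :=
  let ⟨_, hL⟩ := hF x hx a ha
  hL.hasDirDeriv_dirDeriv

theorem dirDifferentiable_const (c : V) : DirDifferentiable M fun _ => c :=
  fun _ _ _ _ => ⟨0, hasDirDeriv_const c⟩

theorem curl_congr {F G : E N → GA N} (h : ∀ y ∈ M, F y = G y) : curl M F = curl M G :=
  funext fun _ => Finset.sum_congr rfl fun _ _ => by rw [dirDeriv_congr h]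

theorem divergence_congr {F G : E N → GA N} (h : ∀ y ∈ M, F y = G y) :
    divergence M F = divergence M G :=
  funext fun _ => Finset.sum_congr rfl fun _ _ => by rw [dirDeriv_congr h]

end Congr

/-! ### First derivatives of the Gauss map -/

theorem sum_sum_eq_zero_of_antisymm {ι V : Type*} [Fintype ι] [AddCommGroup V] [Module ℝ V]
    (f : ι → ι → V) (h : ∀ i j, f i j = -f j i) : ∑ i, ∑ j, f i j = 0 := by
  have h1 : ∑ i, ∑ j, f i j = -∑ i, ∑ j, f i j := by
    conv_lhs => rw [Finset.sum_comm]
    simp only [← Finset.sum_neg_distrib]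
    exact Finset.sum_congr rfl fun i _ => Finset.sum_congr rfl fun j _ => h j i
  have h2 : (2 : ℝ) • ∑ i, ∑ j, f i j = 0 := by
    rw [two_smul]
    exact eq_neg_iff_add_eq_zero.1 h1
  exact (smul_eq_zero.1 h2).resolve_left two_ne_zero

theorem dirDeriv_gaussMap (hM : IsSmoothSubmanifold m M) (hT : IsGaussMap m M T) (hx : x ∈ M)
    (ha : a ∈ tangentSpace M x) : dirDeriv M T x a = shapeDerivation M x a (T x) :=
  (hasDirDeriv_gaussMap hM hT hx ha).dirDeriv_eq (hM.exists_curve hx ha)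

/-- `∂ ⌟ T = 0`, because the second fundamental form is symmetric and contractions anticommute. -/
theorem divergence_gaussMap (hM : IsSmoothSubmanifold m M) (hT : IsGaussMap m M T) (hx : x ∈ M) :
    divergence M T x = 0 := by
  have hmem : ∀ j, (frame M x j : E N) ∈ tangentSpace M x := fun j => (frame M x j).2
  have h1 : divergence M T x = ∑ j, ∑ k, -wedge (vec (projDeriv M x (frame M x j) (frame M x k)))
      (contract (frame M x j : E N) (contract (frame M x k : E N) (T x))) := by
    refine Finset.sum_congr rfl fun j _ => ?_
    rw [dirDeriv_gaussMap hM hT hx (hmem j), shapeDerivation, ← contractₗ_apply, map_sum]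
    refine Finset.sum_congr rfl fun k _ => ?_
    rw [contractₗ_apply, contract_wedge, real_inner_comm,
      inner_projDeriv_frame hM hx (hmem j) (hmem k) (hmem j), zero_smul, zero_sub]
  rw [h1]
  refine sum_sum_eq_zero_of_antisymm _ fun j k => ?_
  rw [hM.projDeriv_symm hx (hmem j) (hmem k), contract_contract, ← vecWedgeₗ_apply, map_neg,
    vecWedgeₗ_apply]

/-- `∂ ∧ T = -H ∧ T`, because `τⱼ ∧ (τₖ ⌟ T)` is `T` for `j = k` and zero otherwise. -/
theorem curl_gaussMap (hM : IsSmoothSubmanifold m M) (hT : IsGaussMap m M T) (hx : x ∈ M) :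
    curl M T x = -wedge (vec (meanCurvature M x)) (T x) := by
  have hmem : ∀ j, (frame M x j : E N) ∈ tangentSpace M x := fun j => (frame M x j).2
  rw [hM.meanCurvature_eq hx, ← vecWedgeₗ_apply, map_sum, LinearMap.sum_apply,
    ← Finset.sum_neg_distrib]
  refine Finset.sum_congr rfl fun j _ => ?_
  rw [dirDeriv_gaussMap hM hT hx (hmem j), shapeDerivation, ← vecWedgeₗ_apply, map_sum,
    Finset.sum_eq_single j]
  · rw [vecWedgeₗ_apply, wedge_wedge, vecWedgeₗ_apply]
    have h1 := contract_wedge (frame M x j : E N) (frame M x j) (T x)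
    rw [hT.wedge_of_tangent hx (hmem j), ← contractₗ_apply _ 0, map_zero, eq_comm, sub_eq_zero,
      real_inner_self_eq_norm_sq, (orthonormal_coe (frame M x)).1 j, one_pow, one_smul] at h1
    rw [← h1]
  · intro k _ hk
    have h1 := contract_wedge (frame M x k : E N) (frame M x j) (T x)
    rw [hT.wedge_of_tangent hx (hmem j), ← contractₗ_apply _ 0, map_zero, eq_comm, sub_eq_zero,
      (orthonormal_coe (frame M x)).2 hk, zero_smul] at h1
    rw [vecWedgeₗ_apply, wedge_wedge, ← h1, ← vecWedgeₗ_apply, map_zero, neg_zero]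
  · exact fun h => absurd (Finset.mem_univ j) h

/-! ### The graded Laplacian of the Gauss map -/

/-- The tangential part of the derivative of the mean curvature is symmetric, being the negative of
the shape operator of `H`. -/
theorem inner_dirDeriv_meanCurvature_symm (hM : IsSmoothSubmanifold m M) (hx : x ∈ M)
    (ha : a ∈ tangentSpace M x) (hb : b ∈ tangentSpace M x) :
    ⟪b, dirDeriv M (meanCurvature M) x a⟫ = ⟪a, dirDeriv M (meanCurvature M) x b⟫ := by
  have key : ∀ {a b : E N}, a ∈ tangentSpace M x → b ∈ tangentSpace M x →
      ⟪b, dirDeriv M (meanCurvature M) x a⟫ = -⟪projDeriv M x a b, meanCurvature M x⟫ := by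
    intro a b ha hb
    have h1 := hM.hasDirDeriv_tangentProj_apply hx
      (hM.dirDifferentiable_meanCurvature.hasDirDeriv hx ha)
    have h2 := h1.unique (hM.exists_curve hx ha) ((hasDirDeriv_const (0 : E N)).congr
      fun y hy => (hM.tangentProj_meanCurvature hy).symm)
    rw [hM.inner_projDeriv hx ha, ← inner_neg_right, ← eq_neg_of_add_eq_zero_left h2,
      tangentProj, ← Submodule.inner_starProjection_left_eq_right,
      Submodule.starProjection_eq_self_iff.2 hb]
  rw [key ha hb, key hb ha, hM.projDeriv_symm hx ha hb]

theorem contract_add (v w : E N) (B : GA N) :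
    contract (v + w) B = contract v B + contract w B := by
  simp only [← contractₗ_apply, map_add, LinearMap.add_apply]

theorem sum_contract_dirDeriv_meanCurvature (hM : IsSmoothSubmanifold m M)
    (hT : IsGaussMap m M T) (hx : x ∈ M) :
    ∑ j, contract (dirDeriv M (meanCurvature M) x (frame M x j))
      (contract (frame M x j : E N) (T x)) = 0 := by
  have hmem : ∀ j, (frame M x j : E N) ∈ tangentSpace M x := fun j => (frame M x j).2
  have h1 : ∀ j, contract (dirDeriv M (meanCurvature M) x (frame M x j))
      (contract (frame M x j : E N) (T x)) =
      ∑ k, ⟪(frame M x k : E N), dirDeriv M (meanCurvature M) x (frame M x j)⟫ •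
        contract (frame M x k : E N) (contract (frame M x j : E N) (T x)) := by
    intro j
    set h := dirDeriv M (meanCurvature M) x (frame M x j)
    have hP : tangentProj M x h ∈ tangentSpace M x := Submodule.starProjection_apply_mem _ _
    have hn : tangentProj M x (h - tangentProj M x h) = 0 := by
      rw [map_sub, tangentProj_of_mem hP, sub_self]
    have hsum : tangentProj M x h = ∑ k, ⟪(frame M x k : E N), h⟫ • (frame M x k : E N) := by
      rw [sum_inner_frame_smul hP]
      refine Finset.sum_congr rfl fun k _ => ?_
      rw [tangentProj, ← Submodule.inner_starProjection_left_eq_right,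
        Submodule.starProjection_eq_self_iff.2 (hmem k)]
    conv_lhs => rw [← add_sub_cancel (tangentProj M x h) h]
    rw [contract_add, contract_contract (h - _), hT.contract_of_normal hx hn,
      ← contractₗ_apply _ 0, map_zero, neg_zero, add_zero, hsum, ← contractₗ_apply]
    simp only [map_sum, map_smul, LinearMap.sum_apply, LinearMap.smul_apply, contractₗ_apply]
  simp only [h1]
  refine sum_sum_eq_zero_of_antisymm _ fun j k => ?_
  rw [inner_dirDeriv_meanCurvature_symm hM hx (hmem j) (hmem k), contract_contract, smul_neg]

theorem dirDifferentiable_gaussMap (hM : IsSmoothSubmanifold m M) (hT : IsGaussMap m M T) :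
    DirDifferentiable M T :=
  fun _ hx _ ha => ⟨_, hasDirDeriv_gaussMap hM hT hx ha⟩

theorem hasDirDeriv_curl_gaussMap (hM : IsSmoothSubmanifold m M) (hT : IsGaussMap m M T)
    (hx : x ∈ M) (ha : a ∈ tangentSpace M x) :
    HasDirDeriv M (curl M T) x a
      (-(wedge (vec (meanCurvature M x)) (dirDeriv M T x a) +
        wedge (vec (dirDeriv M (meanCurvature M) x a)) (T x))) :=
  (((hM.dirDifferentiable_meanCurvature.hasDirDeriv hx ha).bilinear (vecWedgeₗ N)
    ((dirDifferentiable_gaussMap hM hT).hasDirDeriv hx ha)).linear (-LinearMap.id)).congr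
    fun _ hy => (curl_gaussMap hM hT hy).symm

theorem hasGradedLaplacian_gaussMap (hM : IsSmoothSubmanifold m M) (hT : IsGaussMap m M T) :
    HasGradedLaplacian M T :=
  ⟨dirDifferentiable_gaussMap hM hT,
    fun _ hx _ ha => ⟨_, hasDirDeriv_curl_gaussMap hM hT hx ha⟩,
    (dirDifferentiable_const 0).congr fun _ hy => (divergence_gaussMap hM hT hy).symm⟩

theorem curl_vec_meanCurvature (hM : IsSmoothSubmanifold m M) (hx : x ∈ M) :
    curl M (fun y => vec (meanCurvature M y)) x =
      ∑ j, wedge (vec (frame M x j : E N))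
        (vec (dirDeriv M (meanCurvature M) x (frame M x j))) :=
  Finset.sum_congr rfl fun j _ => by
    rw [((hM.dirDifferentiable_meanCurvature.hasDirDeriv hx (frame M x j).2).linear
      vec).dirDeriv_eq (hM.exists_curve hx (frame M x j).2)]

theorem wedge_vec_vec (v w : E N) :
    wedge (vec v) (vec w) = vec v * vec w - algebraMap ℝ (GA N) ⟪v, w⟫ := by
  have h := contract_vec_mul v w 1
  rw [mul_one, contract_one, mul_zero, sub_zero, ← Algebra.algebraMap_eq_smul_one] at h
  rw [wedge_vec, h]

theorem gradedLaplacian_gaussMap (hM : IsSmoothSubmanifold m M) (hT : IsGaussMap m M T)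
    (hx : x ∈ M) :
    gradedLaplacian M T x = -(curl M (fun y => vec (meanCurvature M y)) x * T x) := by
  have hmem : ∀ j, (frame M x j : E N) ∈ tangentSpace M x := fun j => (frame M x j).2
  have h0 : curl M (divergence M T) x = 0 := by
    refine Finset.sum_eq_zero fun j _ => ?_
    rw [((hasDirDeriv_const (0 : GA N)).congr fun y hy =>
      (divergence_gaussMap hM hT hy).symm).dirDeriv_eq (hM.exists_curve hx (hmem j)),
      ← vecWedgeₗ_apply, map_zero]
  have hH : ∀ j, ⟪(frame M x j : E N), meanCurvature M x⟫ = 0 := fun j => by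
    rw [← tangentProj_of_mem (hmem j), tangentProj, Submodule.inner_starProjection_left_eq_right]
    exact (congrArg (fun u => ⟪(frame M x j : E N), u⟫) (hM.tangentProj_meanCurvature hx)).trans
      (inner_zero_right _)
  have h1 : ∀ j, contract (frame M x j : E N) (dirDeriv M (curl M T) x (frame M x j)) =
      -(wedge (vec (frame M x j : E N)) (vec (dirDeriv M (meanCurvature M) x (frame M x j))) *
        T x) -
      contract (dirDeriv M (meanCurvature M) x (frame M x j))
        (contract (frame M x j : E N) (T x)) +
      wedge (vec (meanCurvature M x))
        (contract (frame M x j : E N) (dirDeriv M T x (frame M x j))) := by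
    intro j
    have hw := hT.wedge_of_tangent hx (hmem j)
    rw [wedge_vec, sub_eq_zero] at hw
    rw [(hasDirDeriv_curl_gaussMap hM hT hx (hmem j)).dirDeriv_eq (hM.exists_curve hx (hmem j)),
      ← contractₗ_apply, map_neg, map_add, contractₗ_apply, contractₗ_apply, contract_wedge,
      contract_wedge, hH j, zero_smul, wedge_vec_vec]
    set h := dirDeriv M (meanCurvature M) x (frame M x j)
    set τ : E N := (frame M x j : E N)
    have h2 : vec τ * vec h = algebraMap ℝ (GA N) ⟪τ, h⟫ + algebraMap ℝ (GA N) ⟪τ, h⟫ -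
        vec h * vec τ := by
      rw [eq_sub_iff_add_eq, vec_mul_vec_add_swap, two_mul, map_add]
    rw [h2, sub_mul, sub_mul, add_mul, ← Algebra.smul_def, wedge_vec h, mul_assoc, hw]
    abel
  have h2 : divergence M (curl M T) x = -(curl M (fun y => vec (meanCurvature M y)) x * T x) -
      0 + wedge (vec (meanCurvature M x)) (divergence M T x) := by
    rw [← sum_contract_dirDeriv_meanCurvature hM hT hx, curl_vec_meanCurvature hM hx,
      Finset.sum_mul, ← Finset.sum_neg_distrib, ← Finset.sum_sub_distrib, ← vecWedgeₗ_apply,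
      divergence, divergence, map_sum, ← Finset.sum_add_distrib]
    exact Finset.sum_congr rfl fun j _ => h1 j
  rw [gradedLaplacian, h0, h2, divergence_gaussMap hM hT hx, ← vecWedgeₗ_apply, map_zero,
    sub_zero, add_zero, add_zero]

/-! ### The graded Laplacian and duality -/

/-- A multivector `J` such that right multiplication by `J` interchanges exterior products and
contractions with vectors. -/
def IsDualizing (J : GA N) : Prop :=
  ∀ (v : E N) (A : GA N), contract v (A * J) = wedge (vec v) A * J ∧
    wedge (vec v) (A * J) = contract v A * J

theorem isDualizing_smul_pseudoscalar (ε : ℝ) : IsDualizing (ε • pseudoscalar N) := by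
  intro v A
  rw [mul_smul_comm, mul_smul_comm, mul_smul_comm, ← contractₗ_apply v (_ • _), map_smul,
    contractₗ_apply, contract_mul_pseudoscalar, ← vecWedgeₗ_apply v (_ • _), map_smul,
    vecWedgeₗ_apply, wedge_mul_pseudoscalar]
  exact ⟨rfl, rfl⟩

section Dualizing

variable {F : E N → GA N} {J : GA N}

theorem HasDirDeriv.mul_const {L : GA N} (h : HasDirDeriv M F x a L) (J : GA N) :
    HasDirDeriv M (fun y => F y * J) x a (L * J) :=
  h.linear (LinearMap.mulRight ℝ J)

theorem DirDifferentiable.mul_const (hF : DirDifferentiable M F) (J : GA N) :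
    DirDifferentiable M fun y => F y * J :=
  fun _ hx _ ha => ⟨_, (hF.hasDirDeriv hx ha).mul_const J⟩

theorem IsSmoothSubmanifold.curl_mul_dualizing (hM : IsSmoothSubmanifold m M) (hJ : IsDualizing J)
    (hF : DirDifferentiable M F) (hx : x ∈ M) :
    curl M (fun y => F y * J) x = divergence M F x * J := by
  rw [curl, divergence, Finset.sum_mul]
  refine Finset.sum_congr rfl fun j _ => ?_
  rw [((hF.hasDirDeriv hx (frame M x j).2).mul_const J).dirDeriv_eq
    (hM.exists_curve hx (frame M x j).2), (hJ _ _).2]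

theorem IsSmoothSubmanifold.divergence_mul_dualizing (hM : IsSmoothSubmanifold m M)
    (hJ : IsDualizing J) (hF : DirDifferentiable M F) (hx : x ∈ M) :
    divergence M (fun y => F y * J) x = curl M F x * J := by
  rw [curl, divergence, Finset.sum_mul]
  refine Finset.sum_congr rfl fun j _ => ?_
  rw [((hF.hasDirDeriv hx (frame M x j).2).mul_const J).dirDeriv_eq
    (hM.exists_curve hx (frame M x j).2), (hJ _ _).1]

theorem IsSmoothSubmanifold.hasGradedLaplacian_mul_dualizing (hM : IsSmoothSubmanifold m M)
    (hJ : IsDualizing J) (hF : HasGradedLaplacian M F) :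
    HasGradedLaplacian M fun y => F y * J :=
  ⟨hF.1.mul_const J,
    (hF.2.2.mul_const J).congr fun _ hy => (hM.curl_mul_dualizing hJ hF.1 hy).symm,
    (hF.2.1.mul_const J).congr fun _ hy => (hM.divergence_mul_dualizing hJ hF.1 hy).symm⟩

theorem IsSmoothSubmanifold.gradedLaplacian_mul_dualizing (hM : IsSmoothSubmanifold m M)
    (hJ : IsDualizing J) (hF : HasGradedLaplacian M F) (hx : x ∈ M) :
    gradedLaplacian M (fun y => F y * J) x = gradedLaplacian M F x * J := by
  rw [gradedLaplacian, gradedLaplacian,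
    divergence_congr fun _ hy => hM.curl_mul_dualizing hJ hF.1 hy,
    curl_congr fun _ hy => hM.divergence_mul_dualizing hJ hF.1 hy,
    hM.divergence_mul_dualizing hJ hF.2.2 hx, hM.curl_mul_dualizing hJ hF.2.1 hx, add_mul,
    add_comm]

end Dualizing

/-- On `M` the normal blade is a constant multiple of the tangent blade times the pseudoscalar. -/
theorem IsGaussMap.exists_hodge_eq (hT : IsGaussMap m M T) :
    ∃ ε : ℝ, ∀ y ∈ M, hodge (T y) = T y * (ε • pseudoscalar N) := by
  obtain ⟨ε, hε⟩ := exists_reverse_blade N m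
  refine ⟨ε, fun y hy => ?_⟩
  obtain ⟨τ, h⟩ := hT.2 y hy
  have h1 := hε (fun j => (τ j : E N)) fun i j hij => (orthonormal_coe τ).2 hij
  have h2 : CliffordAlgebra.reverse (T y) = ε • T y := by
    rcases h with h | h <;> rw [h]
    · exact h1
    · rw [map_neg, h1, smul_neg]
  rw [hodge, h2, smul_mul_assoc, mul_smul_comm]

theorem HasGradedLaplacian.congr {F G : E N → GA N} (hF : HasGradedLaplacian M F)
    (h : ∀ y ∈ M, F y = G y) : HasGradedLaplacian M G := by
  refine ⟨hF.1.congr h, ?_, ?_⟩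
  · rw [← curl_congr h]
    exact hF.2.1
  · rw [← divergence_congr h]
    exact hF.2.2

theorem gradedLaplacian_congr {F G : E N → GA N} (h : ∀ y ∈ M, F y = G y) :
    gradedLaplacian M F = gradedLaplacian M G := by
  funext x
  rw [gradedLaplacian, gradedLaplacian, curl_congr h, divergence_congr h]

end GeomCalc

end

theorem mainTheorem2 (N m : ℕ) (M : Set (GeomCalc.E N)) (T : GeomCalc.E N → GeomCalc.GA N)
    (hM : GeomCalc.IsSmoothSubmanifold m M) (hT : GeomCalc.IsGaussMap m M T) :
    (∀ b, GeomCalc.DirDifferentiable M (GeomCalc.tangentialField M b)) ∧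
    GeomCalc.DirDifferentiable M (fun y => GeomCalc.vec (GeomCalc.meanCurvature M y)) ∧
    GeomCalc.HasGradedLaplacian M T ∧
    GeomCalc.HasGradedLaplacian M (fun y => GeomCalc.hodge (T y)) ∧
    ∀ x ∈ M,
      GeomCalc.gradedLaplacian M T x =
        -(GeomCalc.curl M (fun y => GeomCalc.vec (GeomCalc.meanCurvature M y)) x * T x) ∧
      GeomCalc.gradedLaplacian M (fun y => GeomCalc.hodge (T y)) x =
        -(GeomCalc.curl M (fun y => GeomCalc.vec (GeomCalc.meanCurvature M y)) x *
          GeomCalc.hodge (T x)) := by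
  obtain ⟨ε, hε⟩ := hT.exists_hodge_eq
  have hJ := GeomCalc.isDualizing_smul_pseudoscalar (N := N) ε
  have hL := GeomCalc.hasGradedLaplacian_gaussMap hM hT
  refine ⟨fun b x hx a _ => ⟨_, hM.hasDirDeriv_tangentialField hx⟩,
    fun x hx a ha => ⟨_, (hM.dirDifferentiable_meanCurvature.hasDirDeriv hx ha).linear
      GeomCalc.vec⟩, hL,
    (hM.hasGradedLaplacian_mul_dualizing hJ hL).congr fun y hy => (hε y hy).symm,
    fun x hx => ⟨GeomCalc.gradedLaplacian_gaussMap hM hT hx, ?_⟩⟩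
  rw [GeomCalc.gradedLaplacian_congr hε, hM.gradedLaplacian_mul_dualizing hJ hL hx,
    GeomCalc.gradedLaplacian_gaussMap hM hT hx, hε x hx, neg_mul, mul_assoc]
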